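/- Let $1\le s\le K$, $p\ge 1$, $N\ge 1$ be integers, let $A\in\mathbb{R}^{p\times K}$ have columns in the probability simplex $\Delta_p$, and let $T_*\in\mathcal{T}(s)=\{T\in\Delta_K: |\mathrm{supp}(T)|=s\}$. Put $\Pi_*=AT_*$, $S_*=\mathrm{supp}(T_*)$, $T_{\min}=\min_{k\in S_*}T_{*k}$. Let $NX\sim\mathrm{Multinomial}_p(N;\Pi_*)$ and let $\widehat T_{\rm mle}$ be a maximizer over $T\in\Delta_K$ of $\sum_{j:X_j>0}X_j\log(A_{j\cdot}^\top T)$ (with $\log 0=-\infty$). Define \[ \overline J=\{j:\Pi_{*j}>0\},\qquad \underline J=\{j:\Pi_{*j}>2\varepsilon_j\},\qquad \varepsilon_j=2\sqrt{\frac{\Pi_{*j}\log p}{N}}+\frac{4\log p}{3N}, \] \[ \xi=\max_{j\in\overline J}\frac{\|A_{jS_*^c}\|_\infty}{\|A_{jS_*}\|_1}\quad(\xi=0\text{ if }s=K), \] and, for $J\subseteq[p]$ and $1\le r\le K$, with $\mathcal{C}(S)=\{v\in\mathbb{R}^K\setminus\{0\}:\|v_S\|_1\ge\|v_{S^c}\|_1\}$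 and $A_J$ the submatrix of $A$ with rows in $J$, \[ \kappa(A_J,r)=\min_{S\subseteq[K]:|S|\le r}\ \min_{v\in\mathcal{C}(S)}\frac{\|A_Jv\|_1}{\|v\|_1}. \] Assume that $\kappa(A_{\underline J},s)>0$ and $\kappa(A_{\overline J},K)>0$, and let \[ M_1=\frac{\log K}{\kappa^4(A_{\underline J},s)\,T_{\min}^3}(1\vee\xi^3),\qquad M_2=\frac{\log K}{\kappa^2(A_{\overline J},K)\,T_{\min}^2}(1\vee\xi)\bigl(1+\xi\sqrt{K-s}\bigr). \] There are absolute constants $C,C'>0$ such that, whenever $N\ge C\max\{M_1,M_2\}$, with probability at least $1-2p^{-1}-4K^{-1}-2e^{-K}$ a maximum likelihood estimate exists and every maximum likelihood estimate $\widehat T_{\rm mle}$ satisfies \[ \|\widehat T_{\rm mle}-T_*\|_1\le C'\,\kappa^{-1}(A_{\overline J},s)\sqrt{\frac KN}. \] -/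

import Mathlib

open MeasureTheory ProbabilityTheory
open scoped Matrix

noncomputable section

namespace TopicModel

/-- The distribution on `{1, …, p}` that puts mass `π j` at `j`. -/
def categorical {p : ℕ} (π : Fin p → ℝ) : Measure (Fin p) :=
  ∑ j, ENNReal.ofReal (π j) • Measure.dirac j

/-- The vector of numbers of occurrences of each word in a document with `N` words. -/
def wordCounts {p N : ℕ} (w : Fin N → Fin p) : Fin p → ℕ :=
  fun j => (Finset.univ.filter fun i => w i = j).card

/-- The distribution `Multinomial_p(N; π)`: the law of the counts of `N` independent draws
from the distribution `π` on `{1, …, p}`. -/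
def multinomial {p : ℕ} (N : ℕ) (π : Fin p → ℝ) : Measure (Fin p → ℕ) :=
  (Measure.pi fun _ : Fin N => categorical π).map wordCounts

/-- The support of a vector. -/
def supp {K : ℕ} (T : Fin K → ℝ) : Finset (Fin K) :=
  Finset.univ.filter fun k => T k ≠ 0

/-- The class `𝒯(s)` of the vectors of the simplex with exactly `s` nonzero entries. -/
def topicClass (K s : ℕ) : Set (Fin K → ℝ) :=
  {T | T ∈ stdSimplex ℝ (Fin K) ∧ (supp T).card = s}

/-- The `ℓ₁` norm of a vector. -/
def l1 {d : ℕ} (v : Fin d → ℝ) : ℝ := ∑ k, |v k|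

/-- The `ℓ₁` norm of the subvector with indices in `S`. -/
def l1On {d : ℕ} (S : Finset (Fin d)) (v : Fin d → ℝ) : ℝ := ∑ k ∈ S, |v k|

/-- `T` lies in the domain of the log-likelihood of the relative frequencies `X`: every
observed word has positive probability. Outside of it the log-likelihood is `-∞`. -/
def Feasible {p K : ℕ} (A : Matrix (Fin p) (Fin K) ℝ) (X : Fin p → ℝ) (T : Fin K → ℝ) : Prop :=
  ∀ j, 0 < X j → 0 < (A *ᵥ T) j

/-- The log-likelihood, up to a factor and terms free of `T`, on its domain. -/
def logLik {p K : ℕ} (A : Matrix (Fin p) (Fin K) ℝ) (X : Fin p → ℝ) (T : Fin K → ℝ) : ℝ :=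
  ∑ j ∈ Finset.univ.filter (fun j => 0 < X j), X j * Real.log ((A *ᵥ T) j)

/-- `That` is a maximum likelihood estimate: it maximizes the log-likelihood over the simplex. -/
def IsMLE {p K : ℕ} (A : Matrix (Fin p) (Fin K) ℝ) (X : Fin p → ℝ) (That : Fin K → ℝ) : Prop :=
  That ∈ stdSimplex ℝ (Fin K) ∧ Feasible A X That ∧
    ∀ T ∈ stdSimplex ℝ (Fin K), Feasible A X T → logLik A X T ≤ logLik A X That

/-- The cone `𝒞(S)`. -/
def cone {K : ℕ} (S : Finset (Fin K)) : Set (Fin K → ℝ) :=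
  {v | v ≠ 0 ∧ l1On Sᶜ v ≤ l1On S v}

/-- The restricted `ℓ₁ → ℓ₁` condition number `κ(A_J, s)` of the submatrix of `A` with rows
in `J`. -/
def kappa {p K : ℕ} (A : Matrix (Fin p) (Fin K) ℝ) (J : Finset (Fin p)) (s : ℕ) : ℝ :=
  sInf {r | ∃ S : Finset (Fin K), S.card ≤ s ∧ ∃ v ∈ cone S, r = l1On J (A *ᵥ v) / l1 v}

/-- The words of positive probability. -/
def upperJ {p : ℕ} (π : Fin p → ℝ) : Finset (Fin p) :=
  Finset.univ.filter fun j => 0 < π j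

/-- The threshold `ε_j`. -/
def epsJ {p : ℕ} (N : ℕ) (π : Fin p → ℝ) (j : Fin p) : ℝ :=
  2 * √(π j * Real.log p / N) + 4 * Real.log p / (3 * N)

/-- The words of probability larger than `2 ε_j`. -/
def lowerJ {p : ℕ} (N : ℕ) (π : Fin p → ℝ) : Finset (Fin p) :=
  Finset.univ.filter fun j => 2 * epsJ N π j < π j

/-- The smallest nonzero entry of `T`. -/
def tMin {K : ℕ} (T : Fin K → ℝ) : ℝ := ⨅ k : supp T, T k

/-- `ξ`: the maximum over the words `j` of positive probability of
`‖A_{j,Sᶜ}‖_∞ / ‖A_{j,S}‖₁`, with `S` the support of `T` (and `0` if `Sᶜ` is empty). -/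
def xi {p K : ℕ} (A : Matrix (Fin p) (Fin K) ℝ) (T : Fin K → ℝ) : ℝ :=
  ⨆ j : upperJ (A *ᵥ T), (⨆ k : ((supp T)ᶜ : Finset (Fin K)), |A j k|) / l1On (supp T) (A j)

/-- The quantity `M₁`. -/
def M₁ {p K : ℕ} (A : Matrix (Fin p) (Fin K) ℝ) (T : Fin K → ℝ) (s N : ℕ) : ℝ :=
  Real.log K / (kappa A (lowerJ N (A *ᵥ T)) s ^ 4 * tMin T ^ 3) * max 1 (xi A T ^ 3)

/-- The quantity `M₂`. -/
def M₂ {p K : ℕ} (A : Matrix (Fin p) (Fin K) ℝ) (T : Fin K → ℝ) (s : ℕ) : ℝ :=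
  Real.log K / (kappa A (upperJ (A *ᵥ T)) K ^ 2 * tMin T ^ 2) * max 1 (xi A T) *
    (1 + xi A T * √((K : ℝ) - s))

end TopicModel

end

namespace TopicModel

/-! Write π = AT, let s_j = A_j / π_j be the score of word j, with entries in [0, β], β = (1 ∨
ξ)/T_min (`score_le`). The error is measured in the Fisher norm D(u) = ∑ π_j (s_j·u)². By
Cauchy–Schwarz it dominates ‖Au‖₁² over the words of positive probability (`l1On_mulVec_sq_le`),
hence κ²‖u‖₁² on the cone of S_*, which contains every nonzero difference T̂ - T.

Deterministic half (`fisher_norm_sq_le_of_isMLE`): optimality, concavity of log and log(1+x) ≤ x -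
x²/6 give D(u)/12 ≤ ∑ (X_j - π_j) s_j·u for u = t(T̂ - T) with β‖u‖₁ ≤ 1, if the empirical second
moments of the scores are entrywise close to their means. Closeness of the first moments shows that
t = 1 is allowed: otherwise curvature and linear term conflict at radius 1/β. If the right side is
at most √(r D), then D ≤ 144 r.

Probabilistic half (`exists_concentration`): entrywise closeness is Bernstein with a union bound
over at most K² pairs, which needs N of order β³ log K / κ⁴, that is M₁. The sharp r = 5K/N is the
squared dual Fisher norm of the score fluctuation. Under the inverse H⁻¹ of the Fisher matrix a
score has mean squared length tr(H⁻¹H) = K, and Chebyshev controls the deviation once N ≥ β²/κ(A_J̄,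
K)², which M₂ ensures. So no supremum over directions has to be discretized.

Every good event is encoded by a function F ≥ 0 that is at least 1 where the event fails, so failure
probabilities are bounded by finite sums `expect N π F`. The total is at most 4/K. -/

/-- The expectation of `f` under `N` independent draws from the weights `π`. -/
noncomputable def expect {p : ℕ} (N : ℕ) (π : Fin p → ℝ) (f : (Fin N → Fin p) → ℝ) : ℝ :=
  ∑ w, (∏ i, π (w i)) * f w

/-! ### Moments of sums of independent draws. -/

section Expectation

variable {p N : ℕ} {π : Fin p → ℝ}

/-- Separating the first draw drives the inductions on `N` for the moments below. -/
lemma expect_succ (f : (Fin (N + 1) → Fin p) → ℝ) :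
    expect (N + 1) π f = expect N π fun w => ∑ j, π j * f (Fin.cons j w) := by
  unfold expect
  rw [← (Fin.consEquiv fun _ : Fin (N + 1) => Fin p).sum_comp, Fintype.sum_prod_type,
    Finset.sum_comm]
  refine Finset.sum_congr rfl fun w _ => ?_
  rw [Finset.mul_sum]
  refine Finset.sum_congr rfl fun j _ => ?_
  simp [Fin.consEquiv, Fin.prod_univ_succ]
  ring

lemma expect_add (f g : (Fin N → Fin p) → ℝ) :
    expect N π (fun w => f w + g w) = expect N π f + expect N π g := by
  simp [expect, mul_add, Finset.sum_add_distrib]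

lemma expect_mul_left (c : ℝ) (f : (Fin N → Fin p) → ℝ) :
    expect N π (fun w => c * f w) = c * expect N π f := by
  simp only [expect, Finset.mul_sum]
  exact Finset.sum_congr rfl fun w _ => by ring

lemma expect_sum {ι : Type*} (s : Finset ι) (f : ι → (Fin N → Fin p) → ℝ) :
    expect N π (fun w => ∑ k ∈ s, f k w) = ∑ k ∈ s, expect N π (f k) := by
  simp only [expect, Finset.mul_sum]
  exact Finset.sum_comm

lemma expect_prod (f : Fin p → ℝ) :
    expect N π (fun w => ∏ i, f (w i)) = (∑ j, π j * f j) ^ N := by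
  simp [expect, Fintype.sum_pow, Finset.prod_mul_distrib]

lemma expect_const (hπ1 : ∑ j, π j = 1) (c : ℝ) : expect N π (fun _ => c) = c := by
  have h := expect_prod (N := N) (π := π) fun _ => 1
  simp only [Finset.prod_const_one, mul_one, hπ1, one_pow] at h
  simpa [h] using expect_mul_left (N := N) (π := π) c fun _ => 1

lemma expect_mono (hπ : ∀ j, 0 ≤ π j) {f g : (Fin N → Fin p) → ℝ} (h : ∀ w, f w ≤ g w) :
    expect N π f ≤ expect N π g :=
  Finset.sum_le_sum fun w _ =>
    mul_le_mul_of_nonneg_left (h w) (Finset.prod_nonneg fun _ _ => hπ _)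

/-- Bernstein's inequality in exponential moment form. -/
lemma expect_exp_le (hπ : ∀ j, 0 ≤ π j) (hπ1 : ∑ j, π j = 1) {z : Fin p → ℝ} {b V δ : ℝ}
    (hV : 0 < V) (hδ : 0 ≤ δ) (hb : ∀ j, |z j| ≤ b) (hz : ∑ j, π j * z j = 0)
    (hz2 : ∑ j, π j * z j ^ 2 ≤ V) (hbV : δ * b ≤ 2 * V) :
    expect N π (fun w => Real.exp (δ / (2 * V) * (∑ i, z (w i) - N * δ))) ≤
      Real.exp (-(N * (δ ^ 2 / (4 * V)))) := by
  -- This `l` minimizes l²V - lδ. Hypothesis `hbV` keeps |l z_j| ≤ 1, where exp x ≤ 1 + x + x²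
  -- holds.
  set l := δ / (2 * V) with hl
  have hl0 : 0 ≤ l := by positivity
  have key : ∑ j, π j * Real.exp (l * z j) ≤ Real.exp (l ^ 2 * V) := by
    have h1 : ∀ j, Real.exp (l * z j) ≤ 1 + l * z j + (l * z j) ^ 2 := by
      intro j
      have hx : |l * z j| ≤ 1 := by
        rw [abs_mul, abs_of_nonneg hl0]
        calc l * |z j| ≤ l * b := mul_le_mul_of_nonneg_left (hb j) hl0
          _ = δ * b / (2 * V) := by rw [hl]; ring
          _ ≤ 1 := by rw [div_le_one (by positivity)]; exact hbV
      have := (abs_le.1 (Real.abs_exp_sub_one_sub_id_le hx)).2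
      linarith
    calc ∑ j, π j * Real.exp (l * z j) ≤ ∑ j, π j * (1 + l * z j + (l * z j) ^ 2) :=
          Finset.sum_le_sum fun j _ => mul_le_mul_of_nonneg_left (h1 j) (hπ j)
      _ = ∑ j, (π j + l * (π j * z j) + l ^ 2 * (π j * z j ^ 2)) :=
          Finset.sum_congr rfl fun j _ => by ring
      _ = 1 + l ^ 2 * ∑ j, π j * z j ^ 2 := by
          rw [Finset.sum_add_distrib, Finset.sum_add_distrib, ← Finset.mul_sum,
            ← Finset.mul_sum, hπ1, hz]
          ring
      _ ≤ l ^ 2 * V + 1 := by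
          nlinarith [mul_le_mul_of_nonneg_left hz2 (sq_nonneg l)]
      _ ≤ _ := Real.add_one_le_exp _
  have hsplit : (fun w : Fin N → Fin p => Real.exp (l * (∑ i, z (w i) - N * δ))) =
      fun w => Real.exp (-(N * (l * δ))) * ∏ i, Real.exp (l * z (w i)) := by
    funext w
    rw [← Real.exp_sum, ← Real.exp_add, ← Finset.mul_sum]
    congr 1
    ring
  rw [hsplit, expect_mul_left, expect_prod (f := fun j => Real.exp (l * z j))]
  calc Real.exp (-(N * (l * δ))) * (∑ j, π j * Real.exp (l * z j)) ^ N
      ≤ Real.exp (-(N * (l * δ))) * Real.exp (l ^ 2 * V) ^ N := by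
        gcongr
        exact Finset.sum_nonneg fun j _ => mul_nonneg (hπ j) (Real.exp_pos _).le
    _ = Real.exp (-(N * (δ ^ 2 / (4 * V)))) := by
        rw [← Real.exp_nat_mul, ← Real.exp_add, hl]
        congr 1
        field_simp
        ring

variable {V : Type*} [AddCommGroup V] [Module ℝ V] {B : LinearMap.BilinForm ℝ V}
  {z : Fin p → V} {σ R : ℝ}

lemma sum_weight_apply (hz : ∑ j, π j • z j = 0) (x : V) : ∑ j, π j * B x (z j) = 0 := by
  simpa using congrArg (B x) hz

lemma expect_apply_self (hB : B.IsSymm) (hπ1 : ∑ j, π j = 1) (hz : ∑ j, π j • z j = 0)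
    (hσ : ∑ j, π j * B (z j) (z j) = σ) :
    expect N π (fun w => B (∑ i, z (w i)) (∑ i, z (w i))) = N * σ := by
  induction N with
  | zero => simp [expect]
  | succ n ih =>
    rw [expect_succ]
    have : ∀ w : Fin n → Fin p, ∑ j, π j *
        B (∑ i, z ((Fin.cons j w : Fin (n + 1) → Fin p) i))
          (∑ i, z ((Fin.cons j w : Fin (n + 1) → Fin p) i)) =
        B (∑ i, z (w i)) (∑ i, z (w i)) + σ := by
      intro w
      simp only [Fin.sum_univ_succ, Fin.cons_zero, Fin.cons_succ]
      set S := ∑ i, z (w i)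
      calc ∑ j, π j * B (z j + S) (z j + S)
          = ∑ j, (π j * B (z j) (z j) + 2 * (π j * B S (z j)) + π j * B S S) := by
            refine Finset.sum_congr rfl fun j _ => ?_
            simp only [map_add, LinearMap.add_apply]
            rw [hB.eq (z j) S]
            ring
        _ = _ := by
            rw [Finset.sum_add_distrib, Finset.sum_add_distrib, ← Finset.mul_sum,
              ← Finset.sum_mul, hπ1, sum_weight_apply hz, hσ]
            ring
    simp only [this]
    rw [expect_add, ih, expect_const hπ1]
    push_cast
    ring

/-- The variance of the squared length of a sum of independent centred vectors. -/
lemma expect_sq_apply_self_sub_le (hB : B.IsSymm) (hπ : ∀ j, 0 ≤ π j) (hπ1 : ∑ j, π j = 1)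
    (hz : ∑ j, π j • z j = 0) (hσ : ∑ j, π j * B (z j) (z j) = σ)
    (hweak : ∀ x, ∑ j, π j * B x (z j) ^ 2 ≤ B x x)
    (hpos : ∀ j, 0 ≤ B (z j) (z j)) (hR : ∀ j, B (z j) (z j) ≤ R) :
    expect N π (fun w => (B (∑ i, z (w i)) (∑ i, z (w i)) - N * σ) ^ 2) ≤
      4 * N ^ 2 * σ + 2 * N * (R * σ) := by
  have hσ0 : 0 ≤ σ := hσ ▸ Finset.sum_nonneg fun j _ => mul_nonneg (hπ j) (hpos j)
  have hR2 : ∑ j, π j * B (z j) (z j) ^ 2 ≤ R * σ := by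
    rw [← hσ, Finset.mul_sum]
    refine Finset.sum_le_sum fun j _ => ?_
    nlinarith [mul_le_mul_of_nonneg_left (hR j) (mul_nonneg (hπ j) (hpos j))]
  induction N with
  | zero => simp [expect]
  | succ n ih =>
    rw [expect_succ]
    have hstep : ∀ w : Fin n → Fin p, ∑ j, π j *
        (B (∑ i, z ((Fin.cons j w : Fin (n + 1) → Fin p) i))
          (∑ i, z ((Fin.cons j w : Fin (n + 1) → Fin p) i)) - ((n + 1 : ℕ) : ℝ) * σ) ^ 2 ≤
        (B (∑ i, z (w i)) (∑ i, z (w i)) - n * σ) ^ 2 +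
          (8 * B (∑ i, z (w i)) (∑ i, z (w i)) + 2 * (R * σ)) := by
      intro w
      simp only [Fin.sum_univ_succ, Fin.cons_zero, Fin.cons_succ]
      set S := ∑ i, z (w i)
      set q := B S S - n * σ with hq
      -- Adding a draw changes q by d = 2B(S, z_j) + (B(z_j, z_j) - σ), which has mean zero. The
      -- bound on d² is (a + b)² ≤ 2a² + 2b². The weak second moment then leaves 8B(S, S), of mean
      -- 8nσ, which fits into the increment of 4n²σ.
      have hexp : ∀ j, (B (z j + S) (z j + S) - ((n + 1 : ℕ) : ℝ) * σ) ^ 2 ≤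
          q ^ 2 + 2 * q * (2 * B S (z j) + (B (z j) (z j) - σ)) +
            (8 * B S (z j) ^ 2 + 2 * (B (z j) (z j) - σ) ^ 2) := by
        intro j
        have : B (z j + S) (z j + S) - ((n + 1 : ℕ) : ℝ) * σ =
            q + (2 * B S (z j) + (B (z j) (z j) - σ)) := by
          simp only [map_add, LinearMap.add_apply]
          rw [hB.eq (z j) S, hq]
          push_cast
          ring
        rw [this]
        nlinarith [sq_nonneg (2 * B S (z j) - (B (z j) (z j) - σ))]
      calc ∑ j, π j * (B (z j + S) (z j + S) - ((n + 1 : ℕ) : ℝ) * σ) ^ 2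
          ≤ ∑ j, π j * (q ^ 2 + 2 * q * (2 * B S (z j) + (B (z j) (z j) - σ)) +
            (8 * B S (z j) ^ 2 + 2 * (B (z j) (z j) - σ) ^ 2)) :=
            Finset.sum_le_sum fun j _ => mul_le_mul_of_nonneg_left (hexp j) (hπ j)
        _ = ∑ j, ((q ^ 2 - 2 * q * σ + 2 * σ ^ 2) * π j + 4 * q * (π j * B S (z j)) +
              (2 * q - 4 * σ) * (π j * B (z j) (z j)) + 8 * (π j * B S (z j) ^ 2) +
              2 * (π j * B (z j) (z j) ^ 2)) :=
            Finset.sum_congr rfl fun j _ => by ring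
        _ = q ^ 2 - 2 * σ ^ 2 + 8 * (∑ j, π j * B S (z j) ^ 2) +
              2 * ∑ j, π j * B (z j) (z j) ^ 2 := by
            simp only [Finset.sum_add_distrib, ← Finset.mul_sum]
            rw [hπ1, sum_weight_apply hz, hσ]
            ring
        _ ≤ _ := by nlinarith [hweak S, hR2, sq_nonneg σ]
    refine (expect_mono hπ hstep).trans ?_
    rw [expect_add, expect_add, expect_mul_left, expect_const hπ1,
      expect_apply_self hB hπ1 hz hσ]
    push_cast
    nlinarith

end Expectation

/-- With y = √(1+x), log(1+x) = 2 log y ≤ 2(y - 1), and x - 2(y - 1) = (y - 1)² while x² = (y -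
1)²(y + 1)². The claim reduces to (y + 1)² ≤ 6, true since y ≤ √2 < 1.42. -/
lemma log_one_add_le {x : ℝ} (h0 : -1 < x) (h1 : x ≤ 1) : Real.log (1 + x) ≤ x - x ^ 2 / 6 := by
  have hpos : 0 < 1 + x := by linarith
  set y := √(1 + x) with hy
  have hy0 : 0 < y := Real.sqrt_pos.2 hpos
  have hyy : y ^ 2 = 1 + x := Real.sq_sqrt hpos.le
  have hy2 : y ≤ 1.42 := by nlinarith
  have hlog : Real.log (1 + x) ≤ 2 * (y - 1) := by
    rw [← hyy, Real.log_pow]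
    have := Real.log_le_sub_one_of_pos hy0
    push_cast
    linarith
  have hx : x = y ^ 2 - 1 := by linarith
  have h6 : (y + 1) ^ 2 ≤ 6 := by nlinarith
  rw [hx] at hlog ⊢
  nlinarith [mul_nonneg (sub_nonneg.2 h6) (sq_nonneg (y - 1))]

/-- The gradient at `T` of the log-likelihood of a single word `j`. -/
noncomputable def score {p K : ℕ} (A : Matrix (Fin p) (Fin K) ℝ) (T : Fin K → ℝ) (j : Fin p) :
    Fin K → ℝ :=
  fun k => A j k / (A *ᵥ T) j

/-! ### Deterministic analysis of maximum likelihood. -/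

section Deterministic

variable {p K : ℕ} {A : Matrix (Fin p) (Fin K) ℝ} {T : Fin K → ℝ} {X : Fin p → ℝ}

lemma score_dotProduct (u : Fin K → ℝ) (j : Fin p) :
    score A T j ⬝ᵥ u = (A *ᵥ u) j / (A *ᵥ T) j := by
  simp only [score, dotProduct, Matrix.mulVec, Finset.sum_div]
  exact Finset.sum_congr rfl fun k _ => by ring

lemma abs_dotProduct_le {v u : Fin K → ℝ} {b : ℝ} (h : ∀ k, |v k| ≤ b) :
    |v ⬝ᵥ u| ≤ b * l1 u := by
  rw [dotProduct, l1, Finset.mul_sum]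
  refine (Finset.abs_sum_le_sum_abs _ _).trans (Finset.sum_le_sum fun k _ => ?_)
  rw [abs_mul]
  exact mul_le_mul_of_nonneg_right (h k) (abs_nonneg _)

lemma abs_quadratic_le {M : Fin K → Fin K → ℝ} {u : Fin K → ℝ} {b : ℝ}
    (h : ∀ k l, |M k l| ≤ b) : |∑ k, ∑ l, M k l * (u k * u l)| ≤ b * l1 u ^ 2 := by
  calc |∑ k, ∑ l, M k l * (u k * u l)| ≤ ∑ k, ∑ l, b * (|u k| * |u l|) := by
        refine (Finset.abs_sum_le_sum_abs _ _).trans (Finset.sum_le_sum fun k _ => ?_)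
        refine (Finset.abs_sum_le_sum_abs _ _).trans (Finset.sum_le_sum fun l _ => ?_)
        rw [abs_mul, abs_mul]
        exact mul_le_mul_of_nonneg_right (h k l) (by positivity)
    _ = b * l1 u ^ 2 := by
        rw [l1, sq, Finset.sum_mul_sum, Finset.mul_sum]
        simp only [Finset.mul_sum]

lemma mulVec_nonneg (hA : ∀ j k, 0 ≤ A j k) (hT : ∀ k, 0 ≤ T k) (j : Fin p) :
    0 ≤ (A *ᵥ T) j := by
  simp only [Matrix.mulVec, dotProduct]
  exact Finset.sum_nonneg fun k _ => mul_nonneg (hA j k) (hT k)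

lemma sum_mulVec (hA1 : ∀ k, ∑ j, A j k = 1) (u : Fin K → ℝ) :
    ∑ j, (A *ᵥ u) j = ∑ k, u k := by
  simp only [Matrix.mulVec, dotProduct]
  rw [Finset.sum_comm]
  exact Finset.sum_congr rfl fun k _ => by rw [← Finset.sum_mul, hA1, one_mul]

/-- The restricted `ℓ₁` norm of `A u` is bounded by the Fisher information norm of `u`. -/
lemma l1On_mulVec_sq_le (hA : ∀ j k, 0 ≤ A j k) (hA1 : ∀ k, ∑ j, A j k = 1)
    (hT : T ∈ stdSimplex ℝ (Fin K)) (u : Fin K → ℝ) :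
    l1On (upperJ (A *ᵥ T)) (A *ᵥ u) ^ 2 ≤
      ∑ j, (A *ᵥ T) j * (score A T j ⬝ᵥ u) ^ 2 := by
  have h0 := mulVec_nonneg hA hT.1
  -- Splitting off √π_j prepares Cauchy–Schwarz; the factor ∑ π_j equals 1.
  have hle : l1On (upperJ (A *ᵥ T)) (A *ᵥ u) ≤
      ∑ j, √((A *ᵥ T) j) * (√((A *ᵥ T) j) * |score A T j ⬝ᵥ u|) := by
    refine (Finset.sum_le_sum fun j hj => ?_).trans
      (Finset.sum_le_univ_sum_of_nonneg fun j => by positivity)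
    have hj' : 0 < (A *ᵥ T) j := by simpa [upperJ] using hj
    rw [← mul_assoc, Real.mul_self_sqrt hj'.le, score_dotProduct, abs_div, abs_of_pos hj']
    field_simp
    rfl
  calc l1On (upperJ (A *ᵥ T)) (A *ᵥ u) ^ 2
      ≤ (∑ j, √((A *ᵥ T) j) * (√((A *ᵥ T) j) * |score A T j ⬝ᵥ u|)) ^ 2 := by
        have : 0 ≤ l1On (upperJ (A *ᵥ T)) (A *ᵥ u) := Finset.sum_nonneg fun _ _ => abs_nonneg _
        gcongr
    _ ≤ (∑ j, √((A *ᵥ T) j) ^ 2) * ∑ j, (√((A *ᵥ T) j) * |score A T j ⬝ᵥ u|) ^ 2 :=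
        Finset.sum_mul_sq_le_sq_mul_sq _ _ _
    _ = _ := by
        simp only [mul_pow, Real.sq_sqrt (h0 _), sq_abs]
        rw [sum_mulVec hA1, hT.2, one_mul]

/-- Off the support of `T` the difference is nonnegative, and its entries sum to zero, so the mass
gained there is lost on the support. -/
lemma sub_mem_cone {T' : Fin K → ℝ} (hT : T ∈ stdSimplex ℝ (Fin K))
    (hT' : T' ∈ stdSimplex ℝ (Fin K)) (hne : T' - T ≠ 0) : T' - T ∈ cone (supp T) := by
  refine ⟨hne, ?_⟩
  have h1 : l1On (supp T)ᶜ (T' - T) = ∑ k ∈ (supp T)ᶜ, (T' - T) k := by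
    refine Finset.sum_congr rfl fun k hk => abs_of_nonneg ?_
    have : T k = 0 := by simpa [supp] using hk
    simpa [this] using hT'.1 k
  have h2 : ∑ k ∈ supp T, (T' - T) k + ∑ k ∈ (supp T)ᶜ, (T' - T) k = 0 := by
    rw [Finset.sum_add_sum_compl]
    simp [hT.2, hT'.2]
  have h3 : |∑ k ∈ supp T, (T' - T) k| ≤ l1On (supp T) (T' - T) :=
    Finset.abs_sum_le_sum_abs _ _
  rw [h1]
  linarith [neg_abs_le (∑ k ∈ supp T, (T' - T) k)]

lemma l1_nonneg {d : ℕ} (v : Fin d → ℝ) : 0 ≤ l1 v := Finset.sum_nonneg fun _ _ => abs_nonneg _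

lemma l1_pos {d : ℕ} {v : Fin d → ℝ} (hv : v ≠ 0) : 0 < l1 v := by
  obtain ⟨k, hk⟩ := Function.ne_iff.1 hv
  exact (abs_pos.2 hk).trans_le
    (Finset.single_le_sum (f := fun k => |v k|) (fun _ _ => abs_nonneg _) (Finset.mem_univ k))

lemma l1_smul {d : ℕ} (t : ℝ) (v : Fin d → ℝ) : l1 (t • v) = |t| * l1 v := by
  simp [l1, abs_mul, Finset.mul_sum]

/-- Second order expansion of the likelihood along a segment from `T` towards a maximizer. -/
lemma sum_mul_sq_le_of_isMLE
    (hX : ∀ j, 0 ≤ X j) (hXπ : Feasible A X T) (hT : T ∈ stdSimplex ℝ (Fin K))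
    {T' : Fin K → ℝ} (h : IsMLE A X T') {t : ℝ} (ht0 : 0 < t) (ht1 : t ≤ 1)
    (hle : ∀ j, score A T j ⬝ᵥ (t • (T' - T)) ≤ 1) :
    (∑ j, X j * (score A T j ⬝ᵥ (t • (T' - T))) ^ 2) / 6 ≤
      ∑ j, X j * (score A T j ⬝ᵥ (t • (T' - T))) := by
  have hmax := h.2.2 T hT hXπ
  have hterm : ∀ j, 0 < X j → t * (X j * Real.log ((A *ᵥ T') j) - X j * Real.log ((A *ᵥ T) j)) ≤
      X j * (score A T j ⬝ᵥ (t • (T' - T))) -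
        X j * (score A T j ⬝ᵥ (t • (T' - T))) ^ 2 / 6 := by
    intro j hj
    have h1 := hXπ j hj
    have h2 := h.2.1 j hj
    have hx : score A T j ⬝ᵥ (t • (T' - T)) = t * ((A *ᵥ T') j / (A *ᵥ T) j - 1) := by
      rw [dotProduct_smul, score_dotProduct, Matrix.mulVec_sub, Pi.sub_apply, sub_div,
        div_self h1.ne', smul_eq_mul]
    have hr : 0 < (A *ᵥ T') j / (A *ᵥ T) j := div_pos h2 h1
    have hlo : -1 < score A T j ⬝ᵥ (t • (T' - T)) := by
      rw [hx]
      nlinarith [mul_pos ht0 hr]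
    have hlog := log_one_add_le hlo (hle j)
    -- The argument on the right is the convex combination, with weight t, of the likelihood ratio
    -- and 1, and log 1 = 0.
    have hconc : t * (Real.log ((A *ᵥ T') j) - Real.log ((A *ᵥ T) j)) ≤
        Real.log (1 + score A T j ⬝ᵥ (t • (T' - T))) := by
      rw [← Real.log_div h2.ne' h1.ne', hx]
      have := strictConcaveOn_log_Ioi.concaveOn.2 (Set.mem_Ioi.2 hr) (Set.mem_Ioi.2 one_pos)
        ht0.le (sub_nonneg.2 ht1) (by ring)
      simp only [smul_eq_mul, Real.log_one, mul_zero, add_zero] at this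
      refine this.trans_eq (congrArg Real.log ?_)
      ring
    have := mul_le_mul_of_nonneg_left (hconc.trans hlog) hj.le
    linarith
  have hsum : 0 ≤ ∑ j ∈ Finset.univ.filter (fun j => 0 < X j),
      (X j * (score A T j ⬝ᵥ (t • (T' - T))) -
        X j * (score A T j ⬝ᵥ (t • (T' - T))) ^ 2 / 6) := by
    refine le_trans ?_ (Finset.sum_le_sum fun j hj => hterm j (Finset.mem_filter.1 hj).2)
    rw [← Finset.mul_sum, Finset.sum_sub_distrib]
    exact mul_nonneg ht0.le (sub_nonneg.2 hmax)
  rw [Finset.sum_filter_of_ne, Finset.sum_sub_distrib, ← Finset.sum_div] at hsum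
  · linarith
  · intro j _ hne
    refine (hX j).lt_of_ne fun h0 => hne ?_
    simp [← h0]

lemma sum_mul_score_dotProduct (c : Fin p → ℝ) (u : Fin K → ℝ) :
    ∑ j, c j * (score A T j ⬝ᵥ u) = (fun k => ∑ j, c j * score A T j k) ⬝ᵥ u := by
  simp only [dotProduct, Finset.mul_sum, Finset.sum_mul]
  rw [Finset.sum_comm]
  exact Finset.sum_congr rfl fun k _ => Finset.sum_congr rfl fun j _ => by ring

lemma sum_mul_score_dotProduct_sq (c : Fin p → ℝ) (u : Fin K → ℝ) :
    ∑ j, c j * (score A T j ⬝ᵥ u) ^ 2 =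
      ∑ k, ∑ l, (∑ j, c j * (score A T j k * score A T j l)) * (u k * u l) := by
  simp only [dotProduct, sq, Finset.mul_sum, Finset.sum_mul]
  rw [Finset.sum_comm]
  refine Finset.sum_congr rfl fun k _ => ?_
  rw [Finset.sum_comm]
  exact Finset.sum_congr rfl fun l _ => Finset.sum_congr rfl fun j _ => by ring

/-- Deterministic error bound, in the Fisher information norm, for maximum likelihood. -/
lemma fisher_norm_sq_le_of_isMLE (hA : ∀ j k, 0 ≤ A j k) (hA1 : ∀ k, ∑ j, A j k = 1)
    (hX : ∀ j, 0 ≤ X j) (hXπ : Feasible A X T) (hT : T ∈ stdSimplex ℝ (Fin K))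
    {β κ r : ℝ} (hβ : 0 < β) (hκ : 0 < κ) (hscore : ∀ j k, |score A T j k| ≤ β)
    (hcone : ∀ u ∈ cone (supp T), κ * l1 u ≤ l1On (upperJ (A *ᵥ T)) (A *ᵥ u))
    (hlin : ∀ k, |∑ j, (X j - (A *ᵥ T) j) * score A T j k| ≤ κ ^ 2 / (24 * β))
    (hquad : ∀ k l, |∑ j, (X j - (A *ᵥ T) j) * (score A T j k * score A T j l)| ≤ κ ^ 2 / 2)
    (hsup : ∀ u, (∑ j, (X j - (A *ᵥ T) j) * (score A T j ⬝ᵥ u)) ^ 2 ≤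
      r * ∑ j, (A *ᵥ T) j * (score A T j ⬝ᵥ u) ^ 2)
    (hr : 0 ≤ r) {T' : Fin K → ℝ} (h : IsMLE A X T') :
    ∑ j, (A *ᵥ T) j * (score A T j ⬝ᵥ (T' - T)) ^ 2 ≤ 144 * r := by
  by_cases hne : T' - T = 0
  · simp [hne, hr]
  have hl : 0 < l1 (T' - T) := l1_pos hne
  have hc := hcone _ (sub_mem_cone hT h.1 hne)
  have basic : ∀ t : ℝ, 0 < t → t ≤ 1 → t * (β * l1 (T' - T)) ≤ 1 →
      κ ^ 2 * l1 (t • (T' - T)) ^ 2 ≤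
        ∑ j, (A *ᵥ T) j * (score A T j ⬝ᵥ (t • (T' - T))) ^ 2 ∧
      (∑ j, (A *ᵥ T) j * (score A T j ⬝ᵥ (t • (T' - T))) ^ 2) / 12 ≤
        ∑ j, (X j - (A *ᵥ T) j) * (score A T j ⬝ᵥ (t • (T' - T))) := by
    intro t ht0 ht1 htβ
    set u := t • (T' - T) with hu
    have hlu : l1 u = t * l1 (T' - T) := by rw [hu, l1_smul, abs_of_pos ht0]
    have hle : ∀ j, score A T j ⬝ᵥ u ≤ 1 := fun j =>
      (le_abs_self _).trans ((abs_dotProduct_le (hscore j)).trans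
        (by rw [hlu]; linarith))
    have hmle := sum_mul_sq_le_of_isMLE hX hXπ hT h ht0 ht1 hle
    rw [← hu] at hmle
    have hD : κ ^ 2 * l1 u ^ 2 ≤ ∑ j, (A *ᵥ T) j * (score A T j ⬝ᵥ u) ^ 2 := by
      refine le_trans ?_ (l1On_mulVec_sq_le hA hA1 hT u)
      have h1 : l1On (upperJ (A *ᵥ T)) (A *ᵥ u) =
          t * l1On (upperJ (A *ᵥ T)) (A *ᵥ (T' - T)) := by
        rw [hu, Matrix.mulVec_smul]
        simp [l1On, abs_mul, Finset.mul_sum, abs_of_pos ht0]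
      rw [← mul_pow, h1, hlu]
      have : κ * (t * l1 (T' - T)) = t * (κ * l1 (T' - T)) := by ring
      rw [this]
      gcongr
    -- Where π_j = 0 the score is 0 by division by zero, while (Au)_j ≥ 0. Elsewhere the summand is
    -- (Au)_j, and ∑ (Au)_j = ∑ u_k = 0.
    have hneg : ∑ j, (A *ᵥ T) j * (score A T j ⬝ᵥ u) ≤ 0 := by
      calc ∑ j, (A *ᵥ T) j * (score A T j ⬝ᵥ u) ≤ ∑ j, (A *ᵥ u) j := by
            refine Finset.sum_le_sum fun j _ => ?_
            rw [score_dotProduct]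
            rcases (mulVec_nonneg hA hT.1 j).eq_or_lt with h0 | h0
            · rw [← h0, zero_mul, hu, Matrix.mulVec_smul, Matrix.mulVec_sub]
              simp only [Pi.smul_apply, Pi.sub_apply, ← h0, sub_zero, smul_eq_mul]
              exact mul_nonneg ht0.le (mulVec_nonneg hA h.1.1 j)
            · rw [mul_div_cancel₀ _ h0.ne']
        _ = 0 := by
            rw [sum_mulVec hA1, hu]
            simp [← Finset.mul_sum, hT.2, h.1.2]
    have hq := abs_le.1 (abs_quadratic_le (u := u) hquad)
    rw [← sum_mul_score_dotProduct_sq] at hq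
    refine ⟨hD, ?_⟩
    have e1 : ∑ j, (X j - (A *ᵥ T) j) * (score A T j ⬝ᵥ u) ^ 2 =
        ∑ j, X j * (score A T j ⬝ᵥ u) ^ 2 - ∑ j, (A *ᵥ T) j * (score A T j ⬝ᵥ u) ^ 2 := by
      simp only [sub_mul, Finset.sum_sub_distrib]
    have e2 : ∑ j, (X j - (A *ᵥ T) j) * (score A T j ⬝ᵥ u) =
        ∑ j, X j * (score A T j ⬝ᵥ u) - ∑ j, (A *ᵥ T) j * (score A T j ⬝ᵥ u) := by
      simp only [sub_mul, Finset.sum_sub_distrib]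
    rw [e1] at hq
    rw [e2]
    linarith [hq.1]
  -- Localization: otherwise shrink the step to ‖u‖₁ = 1/β. There the curvature gives at least
  -- κ²/(12β²) and the linear term at most κ²/(24β²).
  have hsmall : β * l1 (T' - T) ≤ 1 := by
    by_contra! hbig
    have hpos : 0 < β * l1 (T' - T) := by positivity
    obtain ⟨h1, h2⟩ := basic (β * l1 (T' - T))⁻¹ (by positivity) (inv_le_one_of_one_le₀ hbig.le)
      (by rw [inv_mul_cancel₀ hpos.ne'])
    set u := (β * l1 (T' - T))⁻¹ • (T' - T) with hu
    have hlu : l1 u = β⁻¹ := by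
      rw [hu, l1_smul, abs_of_pos (by positivity)]
      field_simp
    have h3 := (le_abs_self _).trans (abs_dotProduct_le (u := u) hlin)
    rw [← sum_mul_score_dotProduct, hlu] at h3
    rw [hlu] at h1
    have h4 : κ ^ 2 * β⁻¹ ^ 2 / 12 ≤ κ ^ 2 / (24 * β) * β⁻¹ := by linarith
    have h5 : κ ^ 2 / (24 * β) * β⁻¹ = κ ^ 2 * β⁻¹ ^ 2 / 24 := by
      field_simp
    have : 0 < κ ^ 2 * β⁻¹ ^ 2 := by positivity
    linarith
  obtain ⟨h1, h2⟩ := basic 1 one_pos le_rfl (by linarith)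
  rw [one_smul] at h1 h2
  have h3 := hsup (T' - T)
  set D := ∑ j, (A *ᵥ T) j * (score A T j ⬝ᵥ (T' - T)) ^ 2
  have hD0 : 0 < D := lt_of_lt_of_le (by positivity) h1
  have h4 : (D / 12) ^ 2 ≤ r * D := le_trans (by gcongr) h3
  nlinarith

/-- The log-likelihood can be -∞ on the simplex, so compactness is applied to the likelihood itself,
a polynomial because the exponents are the integer counts. A maximizer is feasible since the
likelihood is positive at `T`. -/
lemma exists_isMLE (Y : Fin p → ℕ) {c : ℝ} (hc : 0 < c) (hY : ∀ j, (Y j : ℝ) = c * X j)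
    (hT : T ∈ stdSimplex ℝ (Fin K)) (hfeas : Feasible A X T) (hA : ∀ j k, 0 ≤ A j k) :
    ∃ T', IsMLE A X T' := by
  have hpos : ∀ j, 0 < X j ↔ Y j ≠ 0 := by
    intro j
    rw [← Nat.pos_iff_ne_zero, ← Nat.cast_pos (α := ℝ), hY, mul_pos_iff_of_pos_left hc]
  have hL : ∀ T₀ : Fin K → ℝ, Feasible A X T₀ →
      0 < ∏ j, (A *ᵥ T₀) j ^ Y j ∧
        Real.log (∏ j, (A *ᵥ T₀) j ^ Y j) = c * logLik A X T₀ := by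
    intro T₀ h₀
    have hne : ∀ j, 0 < (A *ᵥ T₀) j ^ Y j := by
      intro j
      by_cases hj : Y j = 0
      · simp [hj]
      · exact pow_pos (h₀ j ((hpos j).2 hj)) _
    refine ⟨Finset.prod_pos fun j _ => hne j, ?_⟩
    rw [Real.log_prod (fun j _ => (hne j).ne'), logLik, Finset.mul_sum, Finset.sum_filter]
    refine Finset.sum_congr rfl fun j _ => ?_
    split_ifs with hj
    · rw [Real.log_pow, hY]; ring
    · simp [not_not.1 (mt (hpos j).2 hj)]
  have hcont : Continuous fun T₀ : Fin K → ℝ => ∏ j, (A *ᵥ T₀) j ^ Y j := by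
    simp only [Matrix.mulVec, dotProduct]
    fun_prop
  obtain ⟨T', hT', hmax⟩ := (isCompact_stdSimplex ℝ (Fin K)).exists_isMaxOn ⟨T, hT⟩
    hcont.continuousOn
  have hle : ∀ T₀ ∈ stdSimplex ℝ (Fin K),
      ∏ j, (A *ᵥ T₀) j ^ Y j ≤ ∏ j, (A *ᵥ T') j ^ Y j := fun T₀ h => hmax h
  have hfeas' : Feasible A X T' := by
    intro j hj
    refine (mulVec_nonneg hA hT'.1 j).lt_of_ne fun h0 => ?_
    have h1 := (hL T hfeas).1.trans_le (hle T hT)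
    rw [Finset.prod_eq_zero (Finset.mem_univ j)] at h1
    · exact h1.false
    · rw [← h0, zero_pow ((hpos j).1 hj)]
  refine ⟨T', hT', hfeas', fun T₀ hT₀ h₀ => ?_⟩
  have h := Real.log_le_log (hL T₀ h₀).1 (hle T₀ hT₀)
  rw [(hL T₀ h₀).2, (hL T' hfeas').2] at h
  exact le_of_mul_le_mul_left h hc

end Deterministic

/-! ### From the multinomial law to finite sums. -/

section Law

variable {p N : ℕ} {π : Fin p → ℝ}

instance : IsFiniteMeasure (categorical π) := by
  have (j : Fin p) : IsFiniteMeasure (ENNReal.ofReal (π j) • Measure.dirac j) :=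
    Measure.smul_finite _ ENNReal.ofReal_ne_top
  unfold categorical
  infer_instance

lemma categorical_singleton (j : Fin p) : categorical π {j} = ENNReal.ofReal (π j) := by
  classical
  simp [categorical, Set.indicator_apply]

lemma pi_categorical_real (hπ : ∀ j, 0 ≤ π j) (G : Set (Fin N → Fin p)) [DecidablePred (· ∈ G)] :
    (Measure.pi fun _ : Fin N => categorical π).real G =
      expect N π fun w => if w ∈ G then 1 else 0 := by
  have h : (Measure.pi fun _ : Fin N => categorical π).real G =
      ∑ w with w ∈ G, (Measure.pi fun _ : Fin N => categorical π).real {w} := by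
    rw [sum_measureReal_singleton]
    simp
  rw [h, Finset.sum_filter, expect]
  refine Finset.sum_congr rfl fun w _ => ?_
  split_ifs
  · rw [measureReal_def, Measure.pi_singleton, ENNReal.toReal_prod, mul_one]
    exact Finset.prod_congr rfl fun i _ => by
      rw [categorical_singleton, ENNReal.toReal_ofReal (hπ _)]
  · simp

/-- A lower bound for multinomial probabilities from a bound on an expectation. -/
lemma one_sub_le_measureReal_of_hasLaw (hπ : ∀ j, 0 ≤ π j) (hπ1 : ∑ j, π j = 1)
    {Ω : Type*} [MeasurableSpace Ω] {P : Measure Ω} {Y : Ω → Fin p → ℕ}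
    (hY : HasLaw Y (multinomial N π) P) {G : Set (Fin p → ℕ)} {F : (Fin N → Fin p) → ℝ}
    (hF0 : ∀ w, 0 ≤ F w)
    (hF : ∀ w, (∀ i, 0 < π (w i)) → wordCounts w ∉ G → 1 ≤ F w) :
    1 - expect N π F ≤ P.real {ω | Y ω ∈ G} := by
  classical
  have hG : MeasurableSet G := .of_discrete
  have hm : Measurable (wordCounts : (Fin N → Fin p) → Fin p → ℕ) := .of_discrete
  have h1 : P.real {ω | Y ω ∈ G} =
      (Measure.pi fun _ : Fin N => categorical π).real (wordCounts ⁻¹' G) := by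
    rw [measureReal_def, measureReal_def]
    change (P (Y ⁻¹' G)).toReal = _
    rw [← Measure.map_apply_of_aemeasurable hY.aemeasurable hG, hY.map_eq, multinomial,
      Measure.map_apply hm hG]
  rw [h1, pi_categorical_real hπ, sub_le_iff_le_add, ← expect_add]
  refine (expect_const (N := N) hπ1 1).symm.trans_le ?_
  refine Finset.sum_le_sum fun w _ => ?_
  by_cases hw : ∀ i, 0 < π (w i)
  · refine mul_le_mul_of_nonneg_left ?_ (Finset.prod_nonneg fun _ _ => hπ _)
    by_cases hwG : wordCounts w ∈ G
    · simp [hwG, hF0 w]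
    · simpa [hwG] using hF w hw hwG
  -- A sequence that uses a word of probability zero has weight zero, so `F` need not detect it.
  · obtain ⟨i, hi⟩ := not_forall.1 hw
    have h0 : π (w i) = 0 := le_antisymm (not_lt.1 hi) (hπ _)
    rw [Finset.prod_eq_zero (Finset.mem_univ i) h0]
    simp

lemma sum_wordCounts_mul (w : Fin N → Fin p) (f : Fin p → ℝ) :
    ∑ j, (wordCounts w j : ℝ) * f j = ∑ i, f (w i) := by
  classical
  rw [← Finset.sum_fiberwise_of_maps_to (fun i _ => Finset.mem_univ (w i)) fun i => f (w i)]
  refine Finset.sum_congr rfl fun j _ => ?_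
  rw [Finset.sum_congr rfl fun i hi => by rw [(Finset.mem_filter.1 hi).2], Finset.sum_const,
    nsmul_eq_mul]
  rfl

end Law

/-! ### Condition numbers, `ξ` and the size of the scores. -/

section ConditionNumber

variable {p K : ℕ} {A : Matrix (Fin p) (Fin K) ℝ} {T : Fin K → ℝ}

lemma l1On_nonneg {d : ℕ} (J : Finset (Fin d)) (v : Fin d → ℝ) : 0 ≤ l1On J v :=
  Finset.sum_nonneg fun _ _ => abs_nonneg _

lemma kappa_mul_le (J : Finset (Fin p)) {s : ℕ} {S : Finset (Fin K)} (hS : S.card ≤ s)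
    {v : Fin K → ℝ} (hv : v ∈ cone S) : kappa A J s * l1 v ≤ l1On J (A *ᵥ v) := by
  rw [← le_div_iff₀ (l1_pos hv.1)]
  refine csInf_le ⟨0, ?_⟩ ⟨S, hS, v, hv, rfl⟩
  rintro _ ⟨S', _, v', _, rfl⟩
  exact div_nonneg (l1On_nonneg _ _) (l1_nonneg _)

/-- `T` is the test vector showing that κ ≤ 1, and it makes the set defining `kappa` nonempty, which
lower bounds on the infimum require. -/
lemma stdSimplex_mem_cone (hT : T ∈ stdSimplex ℝ (Fin K)) : T ∈ cone (supp T) := by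
  refine ⟨?_, ?_⟩
  · rintro rfl
    simpa using hT.2
  · have : l1On (supp T)ᶜ T = 0 := by
      refine Finset.sum_eq_zero fun k hk => ?_
      have : T k = 0 := by simpa [supp] using hk
      simp [this]
    rw [this]
    exact l1On_nonneg _ _

lemma kappa_mono {J J' : Finset (Fin p)} (hJ : J ⊆ J') {s : ℕ}
    (hT : T ∈ stdSimplex ℝ (Fin K)) (hs : (supp T).card ≤ s) : kappa A J s ≤ kappa A J' s := by
  refine le_csInf ⟨_, supp T, hs, T, stdSimplex_mem_cone hT, rfl⟩ ?_
  rintro _ ⟨S, hS, v, hv, rfl⟩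
  rw [le_div_iff₀ (l1_pos hv.1)]
  exact (kappa_mul_le J hS hv).trans
    (Finset.sum_le_sum_of_subset_of_nonneg hJ fun _ _ _ => abs_nonneg _)

lemma kappa_le_one (J : Finset (Fin p)) {s : ℕ} (hA : ∀ j k, 0 ≤ A j k)
    (hA1 : ∀ k, ∑ j, A j k = 1) (hT : T ∈ stdSimplex ℝ (Fin K)) (hs : (supp T).card ≤ s) :
    kappa A J s ≤ 1 := by
  have h1 : l1 T = 1 := by
    rw [← hT.2]
    exact Finset.sum_congr rfl fun k _ => abs_of_nonneg (hT.1 k)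
  have h2 : l1On J (A *ᵥ T) ≤ 1 := by
    calc l1On J (A *ᵥ T) ≤ ∑ j, |(A *ᵥ T) j| :=
          Finset.sum_le_univ_sum_of_nonneg fun j => abs_nonneg _
      _ = ∑ j, (A *ᵥ T) j :=
          Finset.sum_congr rfl fun j _ => abs_of_nonneg (mulVec_nonneg hA hT.1 j)
      _ = 1 := by rw [sum_mulVec hA1, hT.2]
  have := kappa_mul_le (A := A) J hs (stdSimplex_mem_cone hT)
  rw [h1, mul_one] at this
  exact this.trans h2

lemma lowerJ_subset_upperJ {N : ℕ} (π : Fin p → ℝ) : lowerJ N π ⊆ upperJ π := by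
  intro j hj
  have h : 2 * epsJ N π j < π j := by simpa [lowerJ] using hj
  have h0 : 0 ≤ epsJ N π j := by
    have : 0 ≤ Real.log p := Real.log_natCast_nonneg p
    unfold epsJ
    positivity
  simp only [upperJ, Finset.mem_filter, Finset.mem_univ, true_and]
  linarith

lemma supp_nonempty (hT : T ∈ stdSimplex ℝ (Fin K)) : (supp T).Nonempty := by
  by_contra h
  have h0 : ∀ k, T k = 0 := by
    intro k
    by_contra hk
    exact h ⟨k, by simpa [supp] using hk⟩
  simpa [h0] using hT.2

lemma tMin_le {k : Fin K} (hk : k ∈ supp T) : tMin T ≤ T k :=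
  ciInf_le (Set.finite_range fun k : supp T => T k).bddBelow ⟨k, hk⟩

lemma tMin_pos (hT : T ∈ stdSimplex ℝ (Fin K)) : 0 < tMin T := by
  have : Nonempty (supp T) := (supp_nonempty hT).to_subtype
  obtain ⟨k, hk⟩ := exists_eq_ciInf_of_finite (f := fun k : supp T => T k)
  unfold tMin
  rw [← hk]
  exact (hT.1 _).lt_of_ne' (by simpa [supp] using k.2)

lemma tMin_le_one (hT : T ∈ stdSimplex ℝ (Fin K)) : tMin T ≤ 1 := by
  obtain ⟨k, hk⟩ := supp_nonempty hT
  refine (tMin_le hk).trans ?_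
  rw [← hT.2]
  exact Finset.single_le_sum (fun k _ => hT.1 k) (Finset.mem_univ k)

lemma xi_nonneg : 0 ≤ xi A T :=
  Real.iSup_nonneg fun _ =>
    div_nonneg (Real.iSup_nonneg fun _ => abs_nonneg _) (l1On_nonneg _ _)

lemma xi_eq_zero (h : supp T = Finset.univ) : xi A T = 0 := by
  unfold xi
  have : IsEmpty ((supp T)ᶜ : Finset (Fin K)) := by
    rw [h, Finset.compl_univ]
    infer_instance
  simp

lemma l1On_supp_mul_tMin_le (hA : ∀ j k, 0 ≤ A j k) (hT : T ∈ stdSimplex ℝ (Fin K))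
    (j : Fin p) : l1On (supp T) (A j) * tMin T ≤ (A *ᵥ T) j := by
  calc l1On (supp T) (A j) * tMin T = ∑ k ∈ supp T, A j k * tMin T := by
        rw [l1On, Finset.sum_mul]
        exact Finset.sum_congr rfl fun k _ => by rw [abs_of_nonneg (hA j k)]
    _ ≤ ∑ k ∈ supp T, A j k * T k :=
        Finset.sum_le_sum fun k hk => mul_le_mul_of_nonneg_left (tMin_le hk) (hA j k)
    _ ≤ ∑ k, A j k * T k :=
        Finset.sum_le_univ_sum_of_nonneg fun k => mul_nonneg (hA j k) (hT.1 k)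

/-- The scores are bounded by `(1 ∨ ξ) / T_min`. -/
lemma score_le (hA : ∀ j k, 0 ≤ A j k) (hT : T ∈ stdSimplex ℝ (Fin K)) (j : Fin p)
    (k : Fin K) : score A T j k ≤ max 1 (xi A T) / tMin T := by
  have ht := tMin_pos hT
  rcases (mulVec_nonneg hA hT.1 j).eq_or_lt with h0 | h0
  · rw [score, ← h0, div_zero]
    have : (1 : ℝ) ≤ max 1 (xi A T) := le_max_left _ _
    positivity
  rw [score, div_le_div_iff₀ h0 ht]
  have hle := l1On_supp_mul_tMin_le hA hT j
  have hs0 := l1On_nonneg (supp T) (A j)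
  by_cases hk : k ∈ supp T
  · have h1 : A j k ≤ l1On (supp T) (A j) :=
      (le_abs_self _).trans
        (Finset.single_le_sum (f := fun k => |A j k|) (fun _ _ => abs_nonneg _) hk)
    nlinarith [le_max_left 1 (xi A T), mul_le_mul_of_nonneg_right h1 ht.le]
  -- If ‖A_{jS}‖₁ vanished then π_j would vanish too. Hence the quotient in `ξ` is genuine and
  -- bounds A_jk off the support.
  · have hSpos : 0 < l1On (supp T) (A j) := by
      refine hs0.lt_of_ne fun hz => h0.ne ?_
      symm
      simp only [Matrix.mulVec, dotProduct]
      refine Finset.sum_eq_zero fun l _ => ?_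
      by_cases hl : l ∈ supp T
      · have := (Finset.sum_eq_zero_iff_of_nonneg fun _ _ => abs_nonneg _).1 hz.symm l hl
        simp [abs_eq_zero.1 this]
      · have : T l = 0 := by simpa [supp] using hl
        simp [this]
    have hj : j ∈ upperJ (A *ᵥ T) := by simpa [upperJ] using h0
    have h1 : (⨆ k : ((supp T)ᶜ : Finset (Fin K)), |A j k|) / l1On (supp T) (A j) ≤ xi A T :=
      le_ciSup (f := fun j : upperJ (A *ᵥ T) =>
        (⨆ k : ((supp T)ᶜ : Finset (Fin K)), |A j k|) / l1On (supp T) (A j))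
        (Set.finite_range _).bddAbove ⟨j, hj⟩
    have h2 : |A j k| ≤ ⨆ k : ((supp T)ᶜ : Finset (Fin K)), |A j k| :=
      le_ciSup (f := fun k : ((supp T)ᶜ : Finset (Fin K)) => |A j k|)
        (Set.finite_range _).bddAbove ⟨k, by simpa using hk⟩
    have h3 : A j k ≤ xi A T * l1On (supp T) (A j) :=
      (le_abs_self _).trans (h2.trans ((div_le_iff₀ hSpos).1 h1))
    have hξ : 0 ≤ xi A T := xi_nonneg
    calc A j k * tMin T ≤ xi A T * l1On (supp T) (A j) * tMin T := by gcongr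
      _ = xi A T * (l1On (supp T) (A j) * tMin T) := by ring
      _ ≤ max 1 (xi A T) * (A *ᵥ T) j :=
          mul_le_mul (le_max_right _ _) hle (by positivity) (by positivity)

end ConditionNumber

/-! ### The inverse Fisher form. -/

section Fisher

variable {p K : ℕ} {A : Matrix (Fin p) (Fin K) ℝ} {T : Fin K → ℝ}

/-- The Fisher information matrix at `T`. -/
noncomputable def fisher (A : Matrix (Fin p) (Fin K) ℝ) (T : Fin K → ℝ) :
    Matrix (Fin K) (Fin K) ℝ :=
  Matrix.of fun k l => ∑ j, (A *ᵥ T) j * (score A T j k * score A T j l)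

lemma dotProduct_fisher_mulVec (u v : Fin K → ℝ) :
    u ⬝ᵥ (fisher A T *ᵥ v) =
      ∑ j, (A *ᵥ T) j * ((score A T j ⬝ᵥ u) * (score A T j ⬝ᵥ v)) := by
  have h : fisher A T *ᵥ v =
      fun k => ∑ j, ((A *ᵥ T) j * (score A T j ⬝ᵥ v)) * score A T j k := by
    ext k
    rw [Matrix.mulVec, dotProduct]
    simp only [fisher, Matrix.of_apply, Finset.sum_mul]
    rw [Finset.sum_comm]
    refine Finset.sum_congr rfl fun j _ => ?_
    rw [dotProduct, Finset.mul_sum, Finset.sum_mul]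
    exact Finset.sum_congr rfl fun l _ => by ring
  rw [h, dotProduct_comm, ← sum_mul_score_dotProduct]
  exact Finset.sum_congr rfl fun j _ => by ring

/-- The inverse of the Fisher information, as a bilinear form. -/
lemma exists_inverse_fisher (hA : ∀ j k, 0 ≤ A j k) (hA1 : ∀ k, ∑ j, A j k = 1)
    (hT : T ∈ stdSimplex ℝ (Fin K)) {β κ : ℝ} (hκ : 0 < κ)
    (hcone : ∀ u, u ≠ 0 → κ * l1 u ≤ l1On (upperJ (A *ᵥ T)) (A *ᵥ u)) :
    ∃ B : LinearMap.BilinForm ℝ (Fin K → ℝ), B.IsSymm ∧ (∀ x, 0 ≤ B x x) ∧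
      (∀ x, ∑ j, (A *ᵥ T) j * B x (score A T j) ^ 2 = B x x) ∧
      ∑ j, (A *ᵥ T) j * B (score A T j) (score A T j) = K ∧
      (∀ v, (∀ k, |v k| ≤ β) → B v v ≤ β ^ 2 / κ ^ 2) ∧
      ∀ g u, (g ⬝ᵥ u) ^ 2 ≤ B g g * ∑ j, (A *ᵥ T) j * (score A T j ⬝ᵥ u) ^ 2 := by
  have h0 := mulVec_nonneg hA hT.1
  set H := fisher A T with hH
  have hsymm : Hᵀ = H := by
    ext k l
    simp only [hH, fisher, Matrix.transpose_apply, Matrix.of_apply]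
    exact Finset.sum_congr rfl fun j _ => by ring
  have hlow : ∀ u, κ ^ 2 * l1 u ^ 2 ≤ ∑ j, (A *ᵥ T) j * (score A T j ⬝ᵥ u) ^ 2 := by
    intro u
    refine le_trans ?_ (l1On_mulVec_sq_le hA hA1 hT u)
    rw [← mul_pow]
    have := l1_nonneg u
    by_cases hu : u = 0
    · have : l1 u = 0 := by simp [hu, l1]
      rw [this, mul_zero, zero_pow two_ne_zero]
      exact sq_nonneg _
    · have := hcone u hu
      gcongr
  have hquad : ∀ u, u ⬝ᵥ (H *ᵥ u) = ∑ j, (A *ᵥ T) j * (score A T j ⬝ᵥ u) ^ 2 := by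
    intro u
    simp only [hH, dotProduct_fisher_mulVec, sq]
  -- The lower bound on the quadratic form makes H positive definite.
  have hdet : H.det ≠ 0 := by
    intro hdet
    obtain ⟨v, hv, hHv⟩ := Matrix.exists_mulVec_eq_zero_iff.2 hdet
    have h1 := hlow v
    rw [← hquad, hHv, dotProduct_zero] at h1
    have := l1_pos hv
    have : 0 < κ ^ 2 * l1 v ^ 2 := by positivity
    linarith
  have hunit : IsUnit H.det := isUnit_iff_ne_zero.2 hdet
  set W := H⁻¹ with hW
  have hWsymm : Wᵀ = W := by rw [hW, Matrix.transpose_nonsing_inv, hsymm]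
  have hHW : ∀ x, H *ᵥ (W *ᵥ x) = x := fun x => by
    rw [Matrix.mulVec_mulVec, hW, Matrix.mul_nonsing_inv _ hunit, Matrix.one_mulVec]
  have hB : ∀ x y, Matrix.toBilin' W x y = x ⬝ᵥ (W *ᵥ y) := Matrix.toBilin'_apply' W
  have hcomm : ∀ x y, x ⬝ᵥ (W *ᵥ y) = y ⬝ᵥ (W *ᵥ x) := by
    intro x y
    rw [Matrix.dotProduct_mulVec, ← Matrix.mulVec_transpose, hWsymm, dotProduct_comm]
  have hBq : ∀ x, x ⬝ᵥ (W *ᵥ x) = ∑ j, (A *ᵥ T) j * (score A T j ⬝ᵥ (W *ᵥ x)) ^ 2 := by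
    intro x
    rw [← hquad, hHW, dotProduct_comm]
  refine ⟨Matrix.toBilin' W, ⟨fun x y => ?_⟩, fun x => ?_, fun x => ?_, ?_, fun v hv => ?_,
    fun g u => ?_⟩
  · simp only [hB]
    exact hcomm x y
  · rw [hB, hBq]
    exact Finset.sum_nonneg fun j _ => mul_nonneg (h0 j) (sq_nonneg _)
  · rw [hB, hBq]
    exact Finset.sum_congr rfl fun j _ => by rw [hB, hcomm]
  · have htr : (W * H).trace = K := by
      rw [hW, Matrix.nonsing_inv_mul _ hunit]
      simp
    rw [← htr]
    simp only [hB, Matrix.trace, Matrix.diag, Matrix.mul_apply, dotProduct, Matrix.mulVec,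
      Finset.mul_sum, hH, fisher, Matrix.of_apply]
    rw [Finset.sum_comm]
    refine Finset.sum_congr rfl fun k _ => ?_
    rw [Finset.sum_comm]
    exact Finset.sum_congr rfl fun l _ => Finset.sum_congr rfl fun j _ => by ring
  · rw [hB]
    -- With q = v·Wv and l = ‖Wv‖₁: q ≤ βl and κ²l² ≤ q, so κ²q ≤ 2κ²βl - κ⁴l² ≤ β².
    have h1 : v ⬝ᵥ (W *ᵥ v) ≤ β * l1 (W *ᵥ v) := (le_abs_self _).trans (abs_dotProduct_le hv)
    have h2 := hlow (W *ᵥ v)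
    rw [← hBq] at h2
    rw [le_div_iff₀ (by positivity)]
    nlinarith [sq_nonneg (κ ^ 2 * l1 (W *ᵥ v) - β), sq_nonneg κ]
  · rw [hB, hBq]
    -- Since g = H(Wg), g·u is the Fisher inner product of Wg and u, so Cauchy–Schwarz applies.
    have h1 : g ⬝ᵥ u =
        ∑ j, (√((A *ᵥ T) j) * (score A T j ⬝ᵥ (W *ᵥ g))) *
          (√((A *ᵥ T) j) * (score A T j ⬝ᵥ u)) := by
      rw [dotProduct_comm]
      nth_rw 1 [← hHW g]
      rw [hH, dotProduct_fisher_mulVec]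
      refine Finset.sum_congr rfl fun j _ => ?_
      nth_rw 1 [← Real.mul_self_sqrt (h0 j)]
      ring
    rw [h1]
    refine (Finset.sum_mul_sq_le_sq_mul_sq _ _ _).trans_eq ?_
    simp only [mul_pow, Real.sq_sqrt (h0 _)]

end Fisher

/-! ### Bernstein bounds for relative frequencies. -/

section Deviation

variable {p N : ℕ} {π : Fin p → ℝ}

lemma sum_sub_mul_eq (hN : 0 < N) (w : Fin N → Fin p) (f : Fin p → ℝ) :
    ∑ j, ((wordCounts w j : ℝ) / N - π j) * f j =
      (∑ i, (f (w i) - ∑ j, π j * f j)) / N := by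
  have hN' : (N : ℝ) ≠ 0 := by positivity
  rw [Finset.sum_sub_distrib, ← sum_wordCounts_mul w f]
  simp only [sub_mul, Finset.sum_sub_distrib, Finset.sum_const, Finset.card_univ,
    Fintype.card_fin, nsmul_eq_mul]
  rw [sub_div, mul_div_cancel_left₀ _ hN', Finset.sum_div]
  congr 1
  exact Finset.sum_congr rfl fun j _ => by ring

/-- Bernstein's inequality for the relative frequencies. -/
lemma exists_deviation_bound (hπ : ∀ j, 0 ≤ π j) (hπ1 : ∑ j, π j = 1) (hN : 0 < N)
    {f : Fin p → ℝ} {b V δ : ℝ} (hV : 0 < V) (hδ : 0 ≤ δ) (hf0 : ∀ j, 0 ≤ f j)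
    (hfb : ∀ j, f j ≤ b) (hf2 : ∑ j, π j * f j ^ 2 ≤ V) (hbV : δ * b ≤ 2 * V) :
    ∃ F : (Fin N → Fin p) → ℝ, (∀ w, 0 ≤ F w) ∧
      expect N π F ≤ 2 * Real.exp (-(N * (δ ^ 2 / (4 * V)))) ∧
      ∀ w, F w < 1 → |∑ j, ((wordCounts w j : ℝ) / N - π j) * f j| ≤ δ := by
  set m := ∑ j, π j * f j with hm
  have hm0 : 0 ≤ m := Finset.sum_nonneg fun j _ => mul_nonneg (hπ j) (hf0 j)
  have hmb : m ≤ b := by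
    calc m ≤ ∑ j, π j * b := Finset.sum_le_sum fun j _ => mul_le_mul_of_nonneg_left (hfb j) (hπ j)
      _ = b := by rw [← Finset.sum_mul, hπ1, one_mul]
  have hz : ∑ j, π j * (f j - m) = 0 := by
    simp only [mul_sub, Finset.sum_sub_distrib]
    rw [← Finset.sum_mul, hπ1, ← hm]
    ring
  have hz2 : ∑ j, π j * (f j - m) ^ 2 ≤ V := by
    have : ∀ j, π j * (f j - m) ^ 2 = π j * f j ^ 2 - 2 * m * (π j * (f j - m)) - m ^ 2 * π j :=
      fun j => by ring
    simp only [this, Finset.sum_sub_distrib, ← Finset.mul_sum]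
    rw [hz, hπ1]
    nlinarith [sq_nonneg m]
  have hzb : ∀ j, |f j - m| ≤ b := fun j =>
    abs_le.2 ⟨by linarith [hf0 j], by linarith [hfb j]⟩
  have hl : 0 ≤ δ / (2 * V) := by positivity
  -- One exponential per tail: if the sum is below 1, both exponents are negative.
  refine ⟨fun w => Real.exp (δ / (2 * V) * (∑ i, (f (w i) - m) - N * δ)) +
    Real.exp (δ / (2 * V) * (∑ i, -(f (w i) - m) - N * δ)), fun w => by positivity, ?_, ?_⟩
  · rw [expect_add, two_mul (Real.exp _)]
    refine add_le_add (expect_exp_le (z := fun j => f j - m) hπ hπ1 hV hδ hzb hz hz2 hbV)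
      (expect_exp_le (z := fun j => -(f j - m)) hπ hπ1 hV hδ ?_ ?_ ?_ hbV)
    · simpa only [abs_neg] using hzb
    · simpa only [mul_neg, Finset.sum_neg_distrib, neg_eq_zero] using hz
    · simpa only [neg_sq] using hz2
  · intro w hw
    have hN' : (0 : ℝ) < N := by positivity
    have aux : ∀ x : ℝ, Real.exp (δ / (2 * V) * (x - N * δ)) < 1 → x ≤ N * δ := by
      intro x hx
      rw [Real.exp_lt_one_iff] at hx
      by_contra! hlt
      exact absurd hx (not_lt.2 (mul_nonneg hl (by linarith)))
    have h1 := aux _ ((lt_add_of_pos_right _ (Real.exp_pos _)).trans hw)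
    have h2 := aux _ ((lt_add_of_pos_left _ (Real.exp_pos _)).trans hw)
    rw [Finset.sum_neg_distrib] at h2
    rw [sum_sub_mul_eq hN, ← hm, abs_div, abs_of_pos hN', div_le_iff₀ hN', abs_le]
    constructor <;> linarith

end Deviation

/-! ### Fluctuation of the score in the dual Fisher norm. -/

section Score

variable {p K N : ℕ} {A : Matrix (Fin p) (Fin K) ℝ} {T : Fin K → ℝ}

lemma score_nonneg (hA : ∀ j k, 0 ≤ A j k) (hT : T ∈ stdSimplex ℝ (Fin K)) (j : Fin p)
    (k : Fin K) : 0 ≤ score A T j k :=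
  div_nonneg (hA j k) (mulVec_nonneg hA hT.1 j)

lemma sum_mul_score_le_one (hA : ∀ j k, 0 ≤ A j k) (hA1 : ∀ k, ∑ j, A j k = 1) (k : Fin K) :
    ∑ j, (A *ᵥ T) j * score A T j k ≤ 1 := by
  rw [← hA1 k]
  refine Finset.sum_le_sum fun j _ => ?_
  rw [score]
  by_cases h : (A *ᵥ T) j = 0
  · rw [h, zero_mul]
    exact hA j k
  · rw [mul_div_cancel₀ _ h]

/-- The score at the truth has Fisher norm of order `√(K / N)`. -/
lemma exists_score_bound (hA : ∀ j k, 0 ≤ A j k) (hA1 : ∀ k, ∑ j, A j k = 1)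
    (hT : T ∈ stdSimplex ℝ (Fin K)) (hK : 0 < K) (hN : 0 < N) {β κ : ℝ} (hκ : 0 < κ)
    (hβ1 : 1 ≤ β) (hscore : ∀ j k, score A T j k ≤ β)
    (hcone : ∀ u, u ≠ 0 → κ * l1 u ≤ l1On (upperJ (A *ᵥ T)) (A *ᵥ u))
    (hNβ : β ^ 2 / κ ^ 2 ≤ N) :
    ∃ F : (Fin N → Fin p) → ℝ, (∀ w, 0 ≤ F w) ∧
      expect N (A *ᵥ T) F ≤ 1 / K ∧
      ∀ w, F w < 1 → ∀ u,
        (∑ j, ((wordCounts w j : ℝ) / N - (A *ᵥ T) j) * (score A T j ⬝ᵥ u)) ^ 2 ≤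
          5 * (K / N) * ∑ j, (A *ᵥ T) j * (score A T j ⬝ᵥ u) ^ 2 := by
  have hπ := mulVec_nonneg hA hT.1
  have hπ1 : ∑ j, (A *ᵥ T) j = 1 := by rw [sum_mulVec hA1, hT.2]
  have hK' : (0 : ℝ) < K := by positivity
  have hN' : (0 : ℝ) < N := by positivity
  obtain ⟨B, hsymm, hpos, hweak, htr, hbd, hcs⟩ :=
    exists_inverse_fisher (β := β) hA hA1 hT hκ hcone
  set μ := ∑ j, (A *ᵥ T) j • score A T j with hμ
  have hμk : ∀ k, μ k = ∑ j, (A *ᵥ T) j * score A T j k := fun k => by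
    simp [hμ, Finset.sum_apply]
  set z : Fin p → Fin K → ℝ := fun j => score A T j - μ with hz
  have hz0 : ∑ j, (A *ᵥ T) j • z j = 0 := by
    simp only [hz, smul_sub, Finset.sum_sub_distrib]
    rw [← Finset.sum_smul, hπ1, one_smul, ← hμ, sub_self]
  have hμ' : ∀ x, ∑ j, (A *ᵥ T) j * B x (score A T j) = B x μ := fun x => by simp [hμ]
  -- Centring only lowers the second moments, here and in `hσ`.
  have hzweak : ∀ x, ∑ j, (A *ᵥ T) j * B x (z j) ^ 2 ≤ B x x := by
    intro x
    have : ∀ j, (A *ᵥ T) j * B x (z j) ^ 2 = (A *ᵥ T) j * B x (score A T j) ^ 2 -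
        2 * B x μ * ((A *ᵥ T) j * B x (score A T j)) + B x μ ^ 2 * (A *ᵥ T) j := by
      intro j
      simp only [hz, map_sub]
      ring
    simp only [this, Finset.sum_sub_distrib, Finset.sum_add_distrib, ← Finset.mul_sum]
    rw [hweak, hμ', hπ1]
    nlinarith [sq_nonneg (B x μ)]
  have hσ : ∑ j, (A *ᵥ T) j * B (z j) (z j) ≤ K := by
    have : ∀ j, (A *ᵥ T) j * B (z j) (z j) = (A *ᵥ T) j * B (score A T j) (score A T j) -
        2 * ((A *ᵥ T) j * B μ (score A T j)) + B μ μ * (A *ᵥ T) j := by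
      intro j
      simp only [hz, map_sub, LinearMap.sub_apply]
      rw [hsymm.eq (score A T j) μ]
      ring
    simp only [this, Finset.sum_sub_distrib, Finset.sum_add_distrib, ← Finset.mul_sum]
    rw [htr, hμ', hπ1]
    linarith [hpos μ]
  have hzR : ∀ j, B (z j) (z j) ≤ β ^ 2 / κ ^ 2 := by
    intro j
    refine hbd _ fun k => abs_le.2 ?_
    have h1 := score_nonneg hA hT j k
    have h2 := hscore j k
    have h3 : 0 ≤ μ k := hμk k ▸ Finset.sum_nonneg fun j _ =>
      mul_nonneg (hπ j) (score_nonneg hA hT j k)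
    have h4 : μ k ≤ 1 := hμk k ▸ sum_mul_score_le_one hA hA1 k
    simp only [hz, Pi.sub_apply]
    constructor <;> linarith
  set σ := ∑ j, (A *ᵥ T) j * B (z j) (z j) with hσdef
  have hσ0 : 0 ≤ σ := Finset.sum_nonneg fun j _ => mul_nonneg (hπ j) (hpos _)
  -- Chebyshev at deviation 4NK: the variance is at most 6N²K, so failure costs 6/(16K). On the
  -- event B(S, S) ≤ Nσ + 4NK ≤ 5NK.
  refine ⟨fun w => (4 * N * K : ℝ)⁻¹ ^ 2 *
    (B (∑ i, z (w i)) (∑ i, z (w i)) - N * σ) ^ 2, fun w => by positivity, ?_, ?_⟩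
  · rw [expect_mul_left]
    have h := expect_sq_apply_self_sub_le (N := N) hsymm hπ hπ1 hz0 hσdef.symm hzweak
      (fun j => hpos _) hzR
    have h2 : 4 * (N : ℝ) ^ 2 * σ + 2 * N * (β ^ 2 / κ ^ 2 * σ) ≤ 6 * N ^ 2 * K := by
      have : β ^ 2 / κ ^ 2 * σ ≤ N * K := mul_le_mul hNβ hσ hσ0 hN'.le
      nlinarith [mul_le_mul_of_nonneg_left hσ (sq_nonneg (N : ℝ))]
    calc _ ≤ (4 * N * K : ℝ)⁻¹ ^ 2 * (6 * N ^ 2 * K) := by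
          gcongr
          exact h.trans h2
      _ = 6 / 16 * (1 / K) := by
          field_simp
          norm_num
      _ ≤ 1 / K := by
          have : (0 : ℝ) < 1 / K := by positivity
          linarith
  · intro w hw u
    have hS : B (∑ i, z (w i)) (∑ i, z (w i)) ≤ 5 * N * K := by
      beta_reduce at hw
      rw [← mul_pow, sq_lt_one_iff_abs_lt_one, abs_lt] at hw
      have h1 := hw.2
      rw [inv_mul_lt_iff₀ (by positivity)] at h1
      nlinarith [mul_le_mul_of_nonneg_left hσ hN'.le]
    have hlin : ∑ j, ((wordCounts w j : ℝ) / N - (A *ᵥ T) j) * (score A T j ⬝ᵥ u) =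
        ((∑ i, z (w i)) ⬝ᵥ u) / N := by
      rw [sum_sub_mul_eq hN, sum_dotProduct]
      congr 1
      refine Finset.sum_congr rfl fun i _ => ?_
      rw [hz, sub_dotProduct, hμ, sum_dotProduct]
      simp only [smul_dotProduct, smul_eq_mul]
    rw [hlin, div_pow, div_le_iff₀ (by positivity)]
    have hD : 0 ≤ ∑ j, (A *ᵥ T) j * (score A T j ⬝ᵥ u) ^ 2 :=
      Finset.sum_nonneg fun j _ => mul_nonneg (hπ j) (sq_nonneg _)
    refine (hcs _ u).trans ((mul_le_mul_of_nonneg_right hS hD).trans_eq ?_)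
    field_simp

end Score

/-! ### Consequences of the sample size conditions. -/

lemma max_one_pow_three_le (x : ℝ) : max 1 x ^ 3 ≤ max 1 (x ^ 3) := by
  rcases le_total 1 x with h | h
  · rw [max_eq_right h]
    exact le_max_right _ _
  · rw [max_eq_left h]
    simp

section SampleSize

variable {p K s N : ℕ} {A : Matrix (Fin p) (Fin K) ℝ} {T : Fin K → ℝ} {C : ℝ}

lemma le_of_mul_M₁_le (hT : T ∈ stdSimplex ℝ (Fin K)) (hC : 0 < C)
    (hκ : 0 < kappa A (lowerJ N (A *ᵥ T)) s) (h : C * M₁ A T s N ≤ N) :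
    C * Real.log K ≤
      N * (kappa A (lowerJ N (A *ᵥ T)) s ^ 4 / (max 1 (xi A T) / tMin T) ^ 3) := by
  have ht := tMin_pos hT
  set κ := kappa A (lowerJ N (A *ᵥ T)) s
  have hm : 0 < max 1 (xi A T) := one_pos.trans_le (le_max_left _ _)
  have hlog : 0 ≤ Real.log K := Real.log_natCast_nonneg K
  have h1 : C * (Real.log K / (κ ^ 4 * tMin T ^ 3) * max 1 (xi A T) ^ 3) ≤ N := by
    refine le_trans ?_ h
    rw [M₁]
    gcongr
    exact max_one_pow_three_le _
  calc C * Real.log K = C * (Real.log K / (κ ^ 4 * tMin T ^ 3) * max 1 (xi A T) ^ 3) *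
        (κ ^ 4 / (max 1 (xi A T) / tMin T) ^ 3) := by field_simp
    _ ≤ _ := by gcongr

lemma le_of_mul_M₂_le (hT : T ∈ stdSimplex ℝ (Fin K)) (hs : (supp T).card = s) (hsK : s ≤ K)
    (hC : 1 ≤ C) (hlog : 1 ≤ Real.log K) (hκ : 0 < kappa A (upperJ (A *ᵥ T)) K)
    (h : C * M₂ A T s ≤ N) :
    (max 1 (xi A T) / tMin T) ^ 2 / kappa A (upperJ (A *ᵥ T)) K ^ 2 ≤ N := by
  have ht := tMin_pos hT
  have hξ : 0 ≤ xi A T := xi_nonneg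
  set κ := kappa A (upperJ (A *ᵥ T)) K
  have hm : 0 < max 1 (xi A T) := one_pos.trans_le (le_max_left _ _)
  -- For s = K both sides are 1, as ξ = 0; otherwise √(K - s) ≥ 1. Thus one factor 1 ∨ ξ of β² is
  -- absorbed.
  have hmax : max 1 (xi A T) ≤ 1 + xi A T * √((K : ℝ) - s) := by
    refine max_le (by linarith [mul_nonneg hξ (Real.sqrt_nonneg ((K : ℝ) - s))]) ?_
    rcases hsK.eq_or_lt with h' | h'
    · rw [xi_eq_zero ((Finset.card_eq_iff_eq_univ _).1 (by rw [hs, h', Fintype.card_fin]))]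
      simp
    · have h1 : (1 : ℝ) ≤ √((K : ℝ) - s) := by
        rw [Real.one_le_sqrt]
        have : (s : ℝ) + 1 ≤ K := by exact_mod_cast h'
        linarith
      nlinarith
  calc (max 1 (xi A T) / tMin T) ^ 2 / κ ^ 2
      = 1 * (1 / (κ ^ 2 * tMin T ^ 2) * max 1 (xi A T) * max 1 (xi A T)) := by field_simp
    _ ≤ C * (Real.log K / (κ ^ 2 * tMin T ^ 2) * max 1 (xi A T) *
          (1 + xi A T * √((K : ℝ) - s))) := by gcongr
    _ ≤ N := h

end SampleSize

/-! ### The combined good event. -/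

/-- The relative frequencies concentrate in the sense needed by the maximum likelihood
estimator. -/
lemma exists_concentration {p K N : ℕ} {A : Matrix (Fin p) (Fin K) ℝ} {T : Fin K → ℝ}
    (hA : ∀ j k, 0 ≤ A j k) (hA1 : ∀ k, ∑ j, A j k = 1) (hT : T ∈ stdSimplex ℝ (Fin K))
    (hK : 2 ≤ K) (hN : 0 < N) {β κ κ' : ℝ} (hκ : 0 < κ) (hκ1 : κ ≤ 1) (hκ' : 0 < κ')
    (hβ1 : 1 ≤ β) (hscore : ∀ j k, score A T j k ≤ β)
    (hcone : ∀ u, u ≠ 0 → κ' * l1 u ≤ l1On (upperJ (A *ᵥ T)) (A *ᵥ u))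
    (hNβ : β ^ 2 / κ' ^ 2 ≤ N) (hNκ : 10000 * Real.log K ≤ N * (κ ^ 4 / β ^ 3)) :
    ∃ F : (Fin N → Fin p) → ℝ, (∀ w, 0 ≤ F w) ∧ expect N (A *ᵥ T) F ≤ 4 / K ∧
      ∀ w, F w < 1 →
        (∀ k, |∑ j, ((wordCounts w j : ℝ) / N - (A *ᵥ T) j) * score A T j k| ≤
          κ ^ 2 / (24 * β)) ∧
        (∀ k l, |∑ j, ((wordCounts w j : ℝ) / N - (A *ᵥ T) j) *
          (score A T j k * score A T j l)| ≤ κ ^ 2 / 2) ∧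
        ∀ u, (∑ j, ((wordCounts w j : ℝ) / N - (A *ᵥ T) j) * (score A T j ⬝ᵥ u)) ^ 2 ≤
          5 * (K / N) * ∑ j, (A *ᵥ T) j * (score A T j ⬝ᵥ u) ^ 2 := by
  have hπ := mulVec_nonneg hA hT.1
  have hπ1 : ∑ j, (A *ᵥ T) j = 1 := by rw [sum_mulVec hA1, hT.2]
  have hs0 := score_nonneg hA hT
  have hβ0 : 0 < β := one_pos.trans_le hβ1
  have hK' : (2 : ℝ) ≤ K := by exact_mod_cast hK
  have hK0 : (0 : ℝ) < K := by linarith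
  have hκ2 : κ ^ 2 ≤ 1 := pow_le_one₀ hκ.le hκ1
  have hlog : 0 ≤ Real.log K := Real.log_natCast_nonneg K
  -- Since ∑ π_j s_jk ≤ 1, one factor s_jk of a second moment is integrated and only the others are
  -- bounded by β. This gives variances β and β³ rather than β² and β⁴.
  have hsum : ∀ (f : Fin p → ℝ) (c : ℝ) (k : Fin K), 0 ≤ c → (∀ j, f j ≤ c * score A T j k) →
      ∑ j, (A *ᵥ T) j * f j ≤ c := by
    intro f c k hc hf
    calc ∑ j, (A *ᵥ T) j * f j ≤ ∑ j, (A *ᵥ T) j * (c * score A T j k) :=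
          Finset.sum_le_sum fun j _ => mul_le_mul_of_nonneg_left (hf j) (hπ j)
      _ = c * ∑ j, (A *ᵥ T) j * score A T j k := by
          rw [Finset.mul_sum]
          exact Finset.sum_congr rfl fun j _ => by ring
      _ ≤ c * 1 := mul_le_mul_of_nonneg_left (sum_mul_score_le_one hA hA1 k) hc
      _ = c := mul_one c
  have hlin : ∀ k, ∃ F : (Fin N → Fin p) → ℝ, (∀ w, 0 ≤ F w) ∧
      expect N (A *ᵥ T) F ≤
        2 * Real.exp (-(N * ((κ ^ 2 / (24 * β)) ^ 2 / (4 * β)))) ∧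
      ∀ w, F w < 1 → |∑ j, ((wordCounts w j : ℝ) / N - (A *ᵥ T) j) * score A T j k| ≤
        κ ^ 2 / (24 * β) := by
    intro k
    refine exists_deviation_bound (b := β) hπ hπ1 hN hβ0 (by positivity) (fun j => hs0 j k)
      (fun j => hscore j k) (hsum _ _ k hβ0.le fun j => ?_) ?_
    · rw [sq]
      exact mul_le_mul_of_nonneg_right (hscore j k) (hs0 j k)
    · have : κ ^ 2 / (24 * β) * β = κ ^ 2 / 24 := by field_simp
      rw [this]
      linarith
  have hquad : ∀ k l, ∃ F : (Fin N → Fin p) → ℝ, (∀ w, 0 ≤ F w) ∧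
      expect N (A *ᵥ T) F ≤ 2 * Real.exp (-(N * ((κ ^ 2 / 2) ^ 2 / (4 * β ^ 3)))) ∧
      ∀ w, F w < 1 → |∑ j, ((wordCounts w j : ℝ) / N - (A *ᵥ T) j) *
        (score A T j k * score A T j l)| ≤ κ ^ 2 / 2 := by
    intro k l
    refine exists_deviation_bound (b := β ^ 2) hπ hπ1 hN (by positivity) (by positivity)
      (fun j => mul_nonneg (hs0 j k) (hs0 j l)) (fun j => ?_)
      (hsum _ _ k (by positivity) fun j => ?_) ?_
    · rw [sq]
      exact mul_le_mul (hscore j k) (hscore j l) (hs0 j l) hβ0.le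
    · have h1 := hs0 j k
      have h2 := hs0 j l
      calc (score A T j k * score A T j l) ^ 2
          = score A T j l ^ 2 * score A T j k * score A T j k := by ring
        _ ≤ β ^ 2 * β * score A T j k := by
            gcongr
            · exact hscore j l
            · exact hscore j k
        _ = β ^ 3 * score A T j k := by ring
    · have : β ^ 2 ≤ β ^ 3 := pow_le_pow_right₀ hβ1 (by norm_num)
      nlinarith [sq_nonneg β]
  choose F₁ hF₁0 hF₁ hF₁w using hlin
  choose F₂ hF₂0 hF₂ hF₂w using hquad
  obtain ⟨F₃, hF₃0, hF₃, hF₃w⟩ :=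
    exists_score_bound hA hA1 hT (by omega) hN hκ' hβ1 hscore hcone hNβ
  -- 2304 = 24²·4 comes from the linear bound, and 10000/2304 ≥ 4. A tail K⁻⁴ beats the union over
  -- K² pairs.
  have hexp : ∀ x : ℝ, N * (κ ^ 4 / β ^ 3) / 2304 ≤ x →
      Real.exp (-x) ≤ ((K : ℝ) ^ 4)⁻¹ := by
    intro x hx
    have h1 : -x ≤ -(4 * Real.log K) := by linarith
    refine (Real.exp_le_exp.2 h1).trans_eq ?_
    rw [Real.exp_neg, show (4 : ℝ) * Real.log K = ((4 : ℕ) : ℝ) * Real.log K by norm_num,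
      Real.exp_nat_mul, Real.exp_log hK0]
  have he₁ : Real.exp (-(N * ((κ ^ 2 / (24 * β)) ^ 2 / (4 * β)))) ≤ ((K : ℝ) ^ 4)⁻¹ := by
    refine hexp _ (le_of_eq ?_)
    field_simp
    norm_num
  have he₂ : Real.exp (-(N * ((κ ^ 2 / 2) ^ 2 / (4 * β ^ 3)))) ≤ ((K : ℝ) ^ 4)⁻¹ := by
    refine hexp _ ?_
    have h1 : N * ((κ ^ 2 / 2) ^ 2 / (4 * β ^ 3)) = N * (κ ^ 4 / β ^ 3) / 16 := by
      field_simp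
      norm_num
    have h2 : 0 ≤ N * (κ ^ 4 / β ^ 3) := by positivity
    rw [h1]
    linarith
  have h₁0 : ∀ w, 0 ≤ ∑ k, F₁ k w := fun w => Finset.sum_nonneg fun k _ => hF₁0 k w
  have h₂0' : ∀ k w, 0 ≤ ∑ l, F₂ k l w := fun k w => Finset.sum_nonneg fun l _ => hF₂0 k l w
  have h₂0 : ∀ w, 0 ≤ ∑ k, ∑ l, F₂ k l w := fun w => Finset.sum_nonneg fun k _ => h₂0' k w
  refine ⟨fun w => ∑ k, F₁ k w + ∑ k, ∑ l, F₂ k l w + F₃ w,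
    fun w => add_nonneg (add_nonneg (h₁0 w) (h₂0 w)) (hF₃0 w), ?_, fun w hw => ⟨?_, ?_, ?_⟩⟩
  · rw [expect_add, expect_add, expect_sum, expect_sum]
    simp only [expect_sum]
    have e₁ : ∑ k, expect N (A *ᵥ T) (F₁ k) ≤ K * (2 * ((K : ℝ) ^ 4)⁻¹) := by
      refine (Finset.sum_le_card_nsmul _ _ (2 * ((K : ℝ) ^ 4)⁻¹) fun k _ =>
        (hF₁ k).trans (by linarith)).trans_eq ?_
      simp
    have e₂ : ∑ k, ∑ l, expect N (A *ᵥ T) (F₂ k l) ≤ K * (K * (2 * ((K : ℝ) ^ 4)⁻¹)) := by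
      refine (Finset.sum_le_card_nsmul _ _ (K * (2 * ((K : ℝ) ^ 4)⁻¹)) fun k _ => ?_).trans_eq
        (by simp)
      refine (Finset.sum_le_card_nsmul _ _ (2 * ((K : ℝ) ^ 4)⁻¹) fun l _ =>
        (hF₂ k l).trans (by linarith)).trans_eq (by simp)
    have e₃ : K * (2 * ((K : ℝ) ^ 4)⁻¹) ≤ 1 / K := by
      field_simp
      nlinarith
    have e₄ : K * (K * (2 * ((K : ℝ) ^ 4)⁻¹)) ≤ 1 / K := by
      field_simp
      linarith
    have e₅ : 4 / (K : ℝ) = 1 / K + 1 / K + 1 / K + 1 / K := by ring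
    have e₆ : 0 < 1 / (K : ℝ) := by positivity
    linarith
  · intro k
    refine hF₁w k w ?_
    have := Finset.single_le_sum (f := fun k => F₁ k w) (fun k _ => hF₁0 k w)
      (Finset.mem_univ k)
    linarith [h₂0 w, hF₃0 w]
  · intro k l
    refine hF₂w k l w ?_
    have h1 := Finset.single_le_sum (f := fun k => ∑ l, F₂ k l w) (fun k _ => h₂0' k w)
      (Finset.mem_univ k)
    have h2 := Finset.single_le_sum (f := fun l => F₂ k l w) (fun l _ => hF₂0 k l w)
      (Finset.mem_univ l)
    linarith [h₁0 w, hF₃0 w]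
  · exact hF₃w w (by linarith [h₁0 w, h₂0 w])

end TopicModel

/-! ### Assembly. -/

theorem theorem2 :
    ∃ C > (0 : ℝ), ∃ C' > (0 : ℝ),
      ∀ (p K s N : ℕ) (A : Matrix (Fin p) (Fin K) ℝ) (T : Fin K → ℝ),
        1 ≤ s → s ≤ K → 0 < N →
        (∀ k, (fun j => A j k) ∈ stdSimplex ℝ (Fin p)) →
        T ∈ TopicModel.topicClass K s →
        0 < TopicModel.kappa A (TopicModel.lowerJ N (A *ᵥ T)) s →
        0 < TopicModel.kappa A (TopicModel.upperJ (A *ᵥ T)) K →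
        C * max (TopicModel.M₁ A T s N) (TopicModel.M₂ A T s) ≤ N →
        ∀ {Ω : Type*} [MeasurableSpace Ω] (P : Measure Ω) [IsProbabilityMeasure P]
          (X : Ω → Fin p → ℝ) (Y : Ω → Fin p → ℕ),
          (∀ ω j, (Y ω j : ℝ) = N * X ω j) →
          HasLaw Y (TopicModel.multinomial N (A *ᵥ T)) P →
          1 - 2 / (p : ℝ) - 4 / (K : ℝ) - 2 * Real.exp (-(K : ℝ)) ≤
            P.real {ω | (∃ That, TopicModel.IsMLE A (X ω) That) ∧
              ∀ That, TopicModel.IsMLE A (X ω) That →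
                TopicModel.l1 (That - T) ≤
                  C' * ((TopicModel.kappa A (TopicModel.upperJ (A *ᵥ T)) s)⁻¹ *
                    √((K : ℝ) / N))} := by
  refine ⟨10000, by norm_num, 30, by norm_num, ?_⟩
  intro p K s N A T hs1 hsK hN hA hTs hκL hκK hM Ω _ P _ X Y hXY hY
  obtain ⟨hT, hcard⟩ := hTs
  have hA0 : ∀ j k, 0 ≤ A j k := fun j k => (hA k).1 j
  have hA1 : ∀ k, ∑ j, A j k = 1 := fun k => (hA k).2
  have hN' : (0 : ℝ) < N := by positivity
  have hp0 : 0 ≤ 2 / (p : ℝ) := by positivity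
  have he0 : 0 ≤ 2 * Real.exp (-(K : ℝ)) := by positivity
  -- For K ≤ 4 the term 4/K makes the claim vacuous; for K ≥ 5 one has log K ≥ 1.
  rcases Nat.lt_or_ge K 5 with hK5 | hK5
  · refine le_trans ?_ measureReal_nonneg
    have hK0 : (0 : ℝ) < K := by
      have : 0 < K := by omega
      positivity
    have hK4 : (K : ℝ) ≤ 4 := by exact_mod_cast (by omega : K ≤ 4)
    have : 1 ≤ 4 / (K : ℝ) := by rwa [le_div_iff₀ hK0, one_mul]
    linarith
  have hK5' : (5 : ℝ) ≤ K := by exact_mod_cast hK5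
  have hlog : 1 ≤ Real.log K := by
    rw [Real.le_log_iff_exp_le (by linarith)]
    linarith [Real.exp_one_lt_d9]
  set π := A *ᵥ T with hπdef
  set κ := TopicModel.kappa A (TopicModel.lowerJ N π) s with hκ
  set β := max 1 (TopicModel.xi A T) / TopicModel.tMin T with hβ
  have hπ : ∀ j, 0 ≤ π j := TopicModel.mulVec_nonneg hA0 hT.1
  have hπ1 : ∑ j, π j = 1 := by rw [hπdef, TopicModel.sum_mulVec hA1, hT.2]
  have hβ1 : 1 ≤ β := by
    rw [hβ, one_le_div (TopicModel.tMin_pos hT)]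
    exact (TopicModel.tMin_le_one hT).trans (le_max_left _ _)
  have hscore := TopicModel.score_le hA0 hT
  have hM₁ := TopicModel.le_of_mul_M₁_le hT (by norm_num) hκL
    ((mul_le_mul_of_nonneg_left (le_max_left _ _) (by norm_num)).trans hM)
  have hM₂ := TopicModel.le_of_mul_M₂_le hT hcard hsK (by norm_num) hlog hκK
    ((mul_le_mul_of_nonneg_left (le_max_right _ _) (by norm_num)).trans hM)
  have hcone : ∀ u, u ≠ 0 → TopicModel.kappa A (TopicModel.upperJ π) K * TopicModel.l1 u ≤
      TopicModel.l1On (TopicModel.upperJ π) (A *ᵥ u) := by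
    intro u hu
    -- The cone of the full index set consists of all nonzero vectors.
    refine TopicModel.kappa_mul_le _ (S := Finset.univ) (by simp) ⟨hu, ?_⟩
    rw [Finset.compl_univ]
    exact TopicModel.l1On_nonneg _ _
  have hsub := TopicModel.lowerJ_subset_upperJ (N := N) π
  have hκU : κ ≤ TopicModel.kappa A (TopicModel.upperJ π) s :=
    TopicModel.kappa_mono hsub hT hcard.le
  obtain ⟨F, hF0, hFE, hFw⟩ := TopicModel.exists_concentration hA0 hA1 hT (by omega) hN hκL
    (TopicModel.kappa_le_one _ hA0 hA1 hT hcard.le) hκK hβ1 hscore hcone hM₂ hM₁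
  have key := TopicModel.one_sub_le_measureReal_of_hasLaw hπ hπ1 hY
    (G := {y | (∃ That, TopicModel.IsMLE A (fun j => (y j : ℝ) / N) That) ∧
      ∀ That, TopicModel.IsMLE A (fun j => (y j : ℝ) / N) That →
        TopicModel.l1 (That - T) ≤
          30 * ((TopicModel.kappa A (TopicModel.upperJ π) s)⁻¹ * √((K : ℝ) / N))})
    hF0 ?_
  · have hX : ∀ ω, X ω = fun j => (Y ω j : ℝ) / N := fun ω => funext fun j => by
      rw [hXY, mul_div_cancel_left₀ _ hN'.ne']
    simp only [Set.mem_ofPred_eq, ← hX] at key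
    linarith
  intro w hw hwG
  by_contra! hlt
  obtain ⟨hlin, hquad, hsup⟩ := hFw w hlt
  refine hwG ?_
  have hfeas : TopicModel.Feasible A (fun j => (TopicModel.wordCounts w j : ℝ) / N) T := by
    intro j hj
    have hj' : TopicModel.wordCounts w j ≠ 0 := by
      intro h0
      simp [h0] at hj
    obtain ⟨i, hi⟩ := Finset.card_ne_zero.1 hj'
    rw [← (Finset.mem_filter.1 hi).2]
    exact hw i
  refine ⟨TopicModel.exists_isMLE (TopicModel.wordCounts w) hN'
    (fun j => by rw [mul_div_cancel₀ _ hN'.ne']) hT hfeas hA0, fun That hThat => ?_⟩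
  have hD := TopicModel.fisher_norm_sq_le_of_isMLE hA0 hA1 (fun j => by positivity) hfeas hT
    (one_pos.trans_le hβ1) hκL
    (fun j k => by rw [abs_of_nonneg (TopicModel.score_nonneg hA0 hT j k)]; exact hscore j k)
    (fun u hu => (TopicModel.kappa_mul_le _ hcard.le hu).trans
      (Finset.sum_le_sum_of_subset_of_nonneg hsub fun _ _ _ => abs_nonneg _))
    hlin hquad hsup (by positivity) hThat
  have hκU0 : 0 < TopicModel.kappa A (TopicModel.upperJ π) s := hκL.trans_le hκU
  by_cases hne : That - T = 0
  · rw [hne]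
    have : TopicModel.l1 (0 : Fin K → ℝ) = 0 := by simp [TopicModel.l1]
    rw [this]
    positivity
  have h1 := TopicModel.kappa_mul_le (A := A) (TopicModel.upperJ π) hcard.le
    (TopicModel.sub_mem_cone hT hThat.1 hne)
  have h2 := (TopicModel.l1On_mulVec_sq_le hA0 hA1 hT (That - T)).trans hD
  -- The constant 30 comes from D ≤ 144·5·K/N = 720 K/N ≤ 30² K/N.
  have h3 : TopicModel.l1On (TopicModel.upperJ π) (A *ᵥ (That - T)) ≤ 30 * √((K : ℝ) / N) := by
    refine (sq_le_sq₀ (TopicModel.l1On_nonneg _ _) (by positivity)).1 (h2.trans ?_)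
    rw [mul_pow, Real.sq_sqrt (by positivity)]
    have : 0 ≤ (K : ℝ) / N := by positivity
    linarith
  rw [mul_left_comm, ← div_eq_inv_mul, le_div_iff₀' hκU0]
  exact h1.trans h3
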